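/- Fix a constant $\sigma>0$. Let $(n_k),(p_k),(s_k),(d_k)$ be sequences of natural numbers (we drop the index $k$) with $s\le p$, $d\le p$, such that, as $k\to\infty$, $p,s,d\to\infty$, $d=o(p)$ and $ds/p\to\infty$. **Model.** Let $X\in\mathbb R^{n\times p}$ have entries $X_{ij}=B_{ij}N_{ij}$ with $B_{ij}\sim\mathrm{Ber}(d/p)$ and $N_{ij}\sim\mathcal N(0,1)$, let $Z\sim\mathcal N(0,\sigma^2 I_n)$, all the variables $B_{ij},N_{ij},Z_i$ being mutually independent, and for $\beta^\star\in\mathbb R^p$ put $Y=X\beta^\star+Z$. Write $\operatorname{supp}(\beta)=\{i:\beta_i\neq0\}$ and $$\mathcal C_{p,s}=\{\beta\in\mathbb R^p: |\operatorname{supp}(\beta)|=s,\ |\beta_i|\ge1 \text{ for all } i\in\operatorname{supp}(\beta)\}.$$ For $\beta^\star\in\{0,1\}^p$ with $|\operatorname{supp}(\beta^\star)|=s$, a maximum likelihood estimator (MLE) $\hat\beta$ is any minimizer of $\|Y-X\beta\|_2^2$ over $\beta\in\{0,1\}^p$ with $|\operatorname{supp}(\beta)|=s$ (ties are broken arbitrarily).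 **Threshold.** Let 1. $n_{\rm INF}^{\rm SP}=\dfrac{2s\log(p/s)}{\log(ds/p)}$ if $s=o(p)$; 2. $n_{\rm INF}^{\rm SP}=\dfrac{2H(\alpha)p}{\log d}$ if $s/p\to\alpha$ for a constant $\alpha\in(0,1)$ (in particular if $s=\alpha p$), where $H(\alpha)=-\alpha\log\alpha-(1-\alpha)\log(1-\alpha)$. Then in each of these two regimes: (i) If there is $\varepsilon>0$ with $n\le(1-\varepsilon)\,n_{\rm INF}^{\rm SP}$ for all large $k$, then there is no sequence of decoders (measurable maps $g$ from pairs $(X,Y)\in\mathbb R^{n\times p}\times\mathbb R^n$ to subsets of $\{1,\dots,p\}$; in particular none that depend on $Y$ alone) such that $$\sup_{\beta^\star\in\mathcal C_{p,s}}\mathbb P_{X,Z}\big(g(X,Y)\neq\operatorname{supp}(\beta^\star)\big)\longrightarrow0 .$$ (ii) If there is $\varepsilon>0$ with $n\ge(1+\varepsilon)\,n_{\rm INF}^{\rm SP}$ for all large $k$, then for every sequence of signals $\beta^\star\in\{0,1\}^p$ with $|\operatorname{supp}(\beta^\star)|=s$ and every choice of MLE $\hat\beta$, $$\frac{|\operatorname{supp}(\hat\beta)\,\triangle\,\operatorname{supp}(\beta^\star)|}{2s}\longrightarrow0\quad\text{in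 probability.}$$ -/

import Mathlib

open MeasureTheory ProbabilityTheory Filter Topology Asymptotics

noncomputable section

namespace SparseRecovery

/-- The support of a vector: the set of indices of its non-zero components. -/
def supp {p : ℕ} (β : Fin p → ℝ) : Finset (Fin p) :=
  Finset.univ.filter fun i => β i ≠ 0

/-- Real signals with exactly `s` non-zero components, each of absolute value at least `1`. -/
def signalClass (p s : ℕ) : Set (Fin p → ℝ) :=
  {β | (supp β).card = s ∧ ∀ i ∈ supp β, 1 ≤ |β i|}

/-- Binary signals with exactly `s` non-zero components. -/
def binarySignals (p s : ℕ) : Set (Fin p → ℝ) :=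
  {β | (∀ i, β i = 0 ∨ β i = 1) ∧ (supp β).card = s}

/-- The density rate `d / p` as a point of the unit interval. -/
def densityRate (d p : ℕ) (h : d ≤ p) : unitInterval :=
  ⟨(d : ℝ) / p, by positivity, div_le_one_of_le₀ (by exact_mod_cast h) (by positivity)⟩

/-- The random variables behind the model: `B i j` are Bernoulli with mean `d / p`, `N i j` are
standard Gaussian, the noise components `Z i` are centred Gaussian of variance `σ ^ 2`, and all
of them together are mutually independent. -/
structure IsSparseGaussianModel {Ω : Type*} [MeasurableSpace Ω] (P : Measure Ω) {n p : ℕ}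
    (d : ℕ) (hdp : d ≤ p) (σ : ℝ) (B N : Fin n → Fin p → Ω → ℝ) (Z : Fin n → Ω → ℝ) : Prop where
  law_B : ∀ i j, HasLaw (B i j) (bernoulliMeasure 1 0 (densityRate d p hdp)) P
  law_N : ∀ i j, HasLaw (N i j) (gaussianReal 0 1) P
  law_Z : ∀ i, HasLaw (Z i) (gaussianReal 0 ⟨σ ^ 2, sq_nonneg σ⟩) P
  indep : iIndepFun
    (Sum.elim (fun ij : Fin n × Fin p => B ij.1 ij.2)
      (Sum.elim (fun ij : Fin n × Fin p => N ij.1 ij.2) Z)) P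

/-- The sparse Gaussian matrix with entries `B i j * N i j`. -/
def sparseMatrix {Ω : Type*} {n p : ℕ} (B N : Fin n → Fin p → Ω → ℝ) (ω : Ω) :
    Matrix (Fin n) (Fin p) ℝ :=
  Matrix.of fun i j => B i j ω * N i j ω

/-- The observation vector `Y = X β + Z`. -/
def observation {Ω : Type*} {n p : ℕ} (B N : Fin n → Fin p → Ω → ℝ) (Z : Fin n → Ω → ℝ)
    (β : Fin p → ℝ) (ω : Ω) : Fin n → ℝ :=
  (sparseMatrix B N ω).mulVec β + fun i => Z i ω

/-- A decoder: a measurable map from the measurement matrix and the observations to sets of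
indices. Decoders that only look at the observations are a special case. -/
structure Decoder (n p : ℕ) where
  toFun : (Fin n → Fin p → ℝ) → (Fin n → ℝ) → Finset (Fin p)
  measurable_toFun : Measurable (Function.uncurry toFun)

/-- The worst-case probability, over signals in `signalClass p s`, that the decoder misses the
exact support. -/
def worstCaseError {Ω : Type*} [MeasurableSpace Ω] (P : Measure Ω) {n p : ℕ} (s : ℕ)
    (B N : Fin n → Fin p → Ω → ℝ) (Z : Fin n → Ω → ℝ) (g : Decoder n p) : ENNReal :=
  ⨆ β ∈ signalClass p s,
    P {ω | g.toFun (sparseMatrix B N ω) (observation B N Z β ω) ≠ supp β}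

/-- `βhat` is a maximum likelihood estimate: it minimizes `‖Y - X β‖₂²` over binary signals with
`s` non-zero components. -/
def IsMLE {n p : ℕ} (s : ℕ) (X : Matrix (Fin n) (Fin p) ℝ) (Y : Fin n → ℝ)
    (βhat : Fin p → ℝ) : Prop :=
  βhat ∈ binarySignals p s ∧
    IsMinOn (fun β => ‖WithLp.toLp 2 (Y - X.mulVec β)‖ ^ 2) (binarySignals p s) βhat

/-- The normalized support error `|supp βhat ∆ supp β| / (2 s)`. -/
def supportError {p : ℕ} (s : ℕ) (βhat β : Fin p → ℝ) : ℝ :=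
  ((symmDiff (supp βhat) (supp β)).card : ℝ) / (2 * s)

/-- The threshold when `s = o(p)`. -/
def thresholdSublinear (p s d : ℕ) : ℝ :=
  2 * s * Real.log (p / s) / Real.log (d * s / p)

/-- The threshold when `s` is proportional to `p`, with proportion `α`. -/
def thresholdLinear (α : ℝ) (p d : ℕ) : ℝ :=
  2 * Real.binEntropy α * p / Real.log d

/-- Below the threshold `τ` by a constant factor, no sequence of decoders has vanishing worst-case
error for the exact support; above it by a constant factor, the normalized support error of every
version of the MLE (ties being broken arbitrarily) tends to `0` in probability, for every sequence
of binary signals. -/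
def PhaseTransitionAt {Ω : ℕ → Type*} [∀ k, MeasurableSpace (Ω k)] (P : ∀ k, Measure (Ω k))
    (n p s : ℕ → ℕ) (B N : ∀ k, Fin (n k) → Fin (p k) → Ω k → ℝ)
    (Z : ∀ k, Fin (n k) → Ω k → ℝ) (τ : ℕ → ℝ) : Prop :=
  (∀ ε : ℝ, 0 < ε → (∀ᶠ k in atTop, (n k : ℝ) ≤ (1 - ε) * τ k) →
    ¬ ∃ g : ∀ k, Decoder (n k) (p k),
      Tendsto (fun k => worstCaseError (P k) (s k) (B k) (N k) (Z k) (g k)) atTop (𝓝 0)) ∧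
  (∀ ε : ℝ, 0 < ε → (∀ᶠ k in atTop, (1 + ε) * τ k ≤ (n k : ℝ)) →
    ∀ β : ∀ k, Fin (p k) → ℝ, (∀ k, β k ∈ binarySignals (p k) (s k)) →
    ∀ βhat : ∀ k, Ω k → Fin (p k) → ℝ,
      (∀ k, ∀ᵐ ω ∂(P k), IsMLE (s k) (sparseMatrix (B k) (N k) ω)
        (observation (B k) (N k) (Z k) (β k) ω) (βhat k ω)) →
      ∀ δ : ℝ, 0 < δ →
        Tendsto (fun k => P k {ω | δ ≤ supportError (s k) (βhat k ω) (β k)}) atTop (𝓝 0))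

end SparseRecovery

end

/-
Both halves compare `log (p.choose s)`, the information in the support, with
`n / 2 * log (d * s / p)`, the capacity of `n` Gaussian measurements of power `d * s / p`.

Converse: given `X`, the output `Y` is Gaussian around the codeword `X β`, and with probability at
least `1 / 2` its energy is at most twice the average. There its density with respect to one common
Gaussian law is of order at most `(d * s / p) ^ (n / 2)`, so the decoding regions, which are
disjoint, are too small to serve all `p.choose s` supports.

Achievability: a support at distance `m` from the truth beats it with probability at most
`(E exp (-W ^ 2 / (8 * σ ^ 2))) ^ n` by Chernoff's bound, `W` being a linear form with `m` unit
coefficients in one row of `X`. Exchanging the Gaussian weight with its characteristic function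
turns the expectation into a Gaussian average of a product of characteristic functions of
Bernoulli-Gaussian variables, which is of order `(m * d / p) ^ (-1 / 2)`. A union bound over the
supports at distance proportional to `s` concludes.

By Stirling's formula, `2 * log (p.choose s) / log (d * s / p)` is asymptotic to the threshold in
either regime.
-/

noncomputable section

namespace SparseRecovery

open scoped NNReal ENNReal

section ProductMeasures

theorem indicator_univ_pi_prod {ι : Type*} [Fintype ι] {E : ι → Type*}
    (s : ∀ i, Set (E i)) (f : ∀ i, E i → ℝ≥0∞) (x : ∀ i, E i) :
    (Set.univ.pi s).indicator (fun x => ∏ i, f i (x i)) x = ∏ i, (s i).indicator (f i) (x i) := by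
  by_cases hx : x ∈ Set.univ.pi s
  · rw [Set.indicator_of_mem hx]
    exact Finset.prod_congr rfl fun i _ => (Set.indicator_of_mem (hx i (Set.mem_univ i)) _).symm
  · obtain ⟨i, hi⟩ : ∃ i, x i ∉ s i := by simpa using hx
    rw [Set.indicator_of_notMem hx,
      Finset.prod_eq_zero (Finset.mem_univ i) (Set.indicator_of_notMem hi _)]

variable {ι : Type*} [Fintype ι] {E : ι → Type*} [∀ i, MeasurableSpace (E i)]
  (μ : ∀ i, Measure (E i)) [∀ i, IsProbabilityMeasure (μ i)]

theorem lintegral_pi_prod {f : ∀ i, E i → ℝ≥0∞} (hf : ∀ i, Measurable (f i)) :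
    ∫⁻ x, ∏ i, f i (x i) ∂(Measure.pi μ) = ∏ i, ∫⁻ y, f i y ∂(μ i) := by
  rw [lintegral_prod_eq_prod_lintegral_of_indepFun Finset.univ (fun i (x : ∀ i, E i) => f i (x i))
    (iIndepFun_pi fun i => (hf i).aemeasurable) fun i => (hf i).comp (measurable_pi_apply i)]
  exact Finset.prod_congr rfl fun i _ => (measurePreserving_eval μ i).lintegral_comp (hf i)

theorem pi_withDensity {f : ∀ i, E i → ℝ≥0∞} (hf : ∀ i, Measurable (f i))
    [∀ i, SigmaFinite ((μ i).withDensity (f i))] :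
    Measure.pi (fun i => (μ i).withDensity (f i))
      = (Measure.pi μ).withDensity fun x => ∏ i, f i (x i) := by
  refine Measure.pi_eq fun s hs => ?_
  have hs' : MeasurableSet (Set.univ.pi s) := MeasurableSet.univ_pi hs
  rw [withDensity_apply _ hs', ← lintegral_indicator hs']
  simp_rw [indicator_univ_pi_prod]
  rw [lintegral_pi_prod μ fun i => (hf i).indicator (hs i)]
  exact Finset.prod_congr rfl fun i _ => by
    rw [lintegral_indicator (hs i), withDensity_apply _ (hs i)]

end ProductMeasures

section Gaussian

theorem lintegral_exp_neg_mul_sq {b : ℝ} (hb : 0 < b) :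
    ∫⁻ y : ℝ, ENNReal.ofReal (Real.exp (-b * y ^ 2)) = ENNReal.ofReal √(Real.pi / b) := by
  rw [← integral_gaussian, ofReal_integral_eq_lintegral_ofReal (integrable_exp_neg_mul_sq hb)
    (ae_of_all _ fun _ => (Real.exp_pos _).le)]

theorem lintegral_exp_neg_mul_sq_gaussianReal (v : ℝ≥0) {c : ℝ} (hc : 0 ≤ c) :
    ∫⁻ y, ENNReal.ofReal (Real.exp (-(c * y ^ 2))) ∂(gaussianReal 0 v)
      = ENNReal.ofReal (√(1 + 2 * c * v))⁻¹ := by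
  rcases eq_or_ne v 0 with rfl | hv
  · simp
  have : (0 : ℝ) < v := by positivity
  have hdensity : ∀ y : ℝ,
      (gaussianPDF 0 v * fun y => ENNReal.ofReal (Real.exp (-(c * y ^ 2)))) y
        = ENNReal.ofReal (√(2 * Real.pi * v))⁻¹
          * ENNReal.ofReal (Real.exp (-((1 + 2 * c * v) / (2 * v)) * y ^ 2)) := by
    intro y
    simp only [Pi.mul_apply, gaussianPDF, gaussianPDFReal]
    rw [← ENNReal.ofReal_mul (by positivity), ← ENNReal.ofReal_mul (by positivity), mul_assoc,
      ← Real.exp_add]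
    congr 3
    field_simp
    ring
  rw [gaussianReal_of_var_ne_zero _ hv,
    lintegral_withDensity_eq_lintegral_mul _ (measurable_gaussianPDF _ _) (by fun_prop)]
  simp_rw [hdensity]
  rw [lintegral_const_mul _ (by fun_prop), lintegral_exp_neg_mul_sq (by positivity),
    ← ENNReal.ofReal_mul (by positivity)]
  congr 1
  rw [← Real.sqrt_inv, ← Real.sqrt_inv, ← Real.sqrt_mul (by positivity)]
  congr 1
  field_simp

theorem lintegral_exp_mul_gaussianReal (v : ℝ≥0) (t : ℝ) :
    ∫⁻ z, ENNReal.ofReal (Real.exp (t * z)) ∂(gaussianReal 0 v)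
      = ENNReal.ofReal (Real.exp (v * t ^ 2 / 2)) := by
  have hmgf : ∫ z, Real.exp (t * z) ∂(gaussianReal 0 v) = Real.exp (v * t ^ 2 / 2) := by
    simpa [mgf] using congrFun (mgf_id_gaussianReal (μ := 0) (v := v)) t
  rw [← ofReal_integral_eq_lintegral_ofReal (integrable_exp_mul_gaussianReal t)
    (ae_of_all _ fun _ => (Real.exp_pos _).le), hmgf]

theorem lintegral_const_add_sq_gaussianReal (v : ℝ≥0) (c : ℝ) :
    ∫⁻ z, ENNReal.ofReal ((c + z) ^ 2) ∂(gaussianReal 0 v) = ENNReal.ofReal (c ^ 2) + v := by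
  have hid : MemLp id 2 (gaussianReal 0 v) := memLp_id_gaussianReal 2
  have hc : MemLp (fun z => c + z) 2 (gaussianReal 0 v) := (memLp_const c).add hid
  have hmean : ∫ z, (c + z) ∂(gaussianReal 0 v) = c := by
    have hz : Integrable (fun z : ℝ => z) (gaussianReal 0 v) := hid.integrable (by norm_num)
    rw [integral_add (integrable_const _) hz, integral_id_gaussianReal]
    simp
  have hvar : Var[fun z => c + z; gaussianReal 0 v] = v := by
    rw [variance_const_add (by fun_prop), variance_fun_id_gaussianReal]
  rw [variance_eq_sub hc, hmean, sub_eq_iff_eq_add'] at hvar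
  rw [← ofReal_integral_eq_lintegral_ofReal hc.integrable_sq (ae_of_all _ fun _ => sq_nonneg _)]
  simpa only [Pi.pow_apply, ENNReal.ofReal_add (sq_nonneg c) v.coe_nonneg,
    ENNReal.ofReal_coe_nnreal] using congrArg ENNReal.ofReal hvar

theorem integral_charFun_comm {E : Type*} [NormedAddCommGroup E] [InnerProductSpace ℝ E]
    [MeasurableSpace E] [BorelSpace E] [SecondCountableTopology E] (μ ν : Measure E)
    [IsFiniteMeasure μ] [IsFiniteMeasure ν] :
    ∫ t, charFun μ t ∂ν = ∫ t, charFun ν t ∂μ := by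
  have hint : Integrable (fun a : E × E => Complex.exp (inner ℝ a.2 a.1 * Complex.I))
      (ν.prod μ) := by
    refine Integrable.of_bound (by fun_prop) 1 (ae_of_all _ fun a => ?_)
    rw [Complex.norm_exp_ofReal_mul_I]
  simp_rw [charFun_apply]
  rw [integral_integral_swap hint]
  simp_rw [real_inner_comm]

end Gaussian

section GaussianChannel

variable {ι : Type*} [Fintype ι] {𝒳 : Type*} [MeasurableSpace 𝒳]

/-- White Gaussian noise: independent centred components of variance `v`. -/
abbrev gaussianNoise (ι : Type*) [Fintype ι] (v : ℝ≥0) : Measure (ι → ℝ) :=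
  Measure.pi fun _ => gaussianReal 0 v

/-- The additive white Gaussian noise channel with side information: the law of `(x, f x + z)`,
where `x` has law `μ` and is known to the receiver, and `z` is independent noise. -/
def gaussianChannel (μ : Measure 𝒳) (v : ℝ≥0) (f : 𝒳 → ι → ℝ) : Measure (𝒳 × (ι → ℝ)) :=
  (μ.prod (gaussianNoise ι v)).map fun t => (t.1, f t.1 + t.2)

theorem isProbabilityMeasure_gaussianChannel (μ : Measure 𝒳) [IsProbabilityMeasure μ] (v : ℝ≥0)
    {f : 𝒳 → ι → ℝ} (hf : Measurable f) : IsProbabilityMeasure (gaussianChannel μ v f) :=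
  Measure.isProbabilityMeasure_map (by fun_prop)

theorem lintegral_exp_neg_noise_gain {v : ℝ≥0} (hv : v ≠ 0) (w : ℝ) :
    ∫⁻ z, ENNReal.ofReal (Real.exp ((z ^ 2 - (z + w) ^ 2) / (4 * v))) ∂(gaussianReal 0 v)
      = ENNReal.ofReal (Real.exp (-(w ^ 2 / (8 * v)))) := by
  have : (0 : ℝ) < v := by positivity
  have hfactor : ∀ z : ℝ, ENNReal.ofReal (Real.exp ((z ^ 2 - (z + w) ^ 2) / (4 * v)))
      = ENNReal.ofReal (Real.exp (-(w ^ 2 / (4 * v))))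
        * ENNReal.ofReal (Real.exp (-(w / (2 * v)) * z)) := by
    intro z
    rw [← ENNReal.ofReal_mul (Real.exp_pos _).le, ← Real.exp_add]
    congr 2
    field_simp
    ring
  simp_rw [hfactor]
  rw [lintegral_const_mul _ (by fun_prop), lintegral_exp_mul_gaussianReal,
    ← ENNReal.ofReal_mul (Real.exp_pos _).le, ← Real.exp_add]
  congr 2
  field_simp
  ring

-- Chernoff's bound with exponent `1 / (4 v)`, the minimizer of the moment generating function.
theorem gaussianNoise_norm_add_le {v : ℝ≥0} (hv : v ≠ 0) (w : ι → ℝ) :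
    gaussianNoise ι v {z | ∑ i, (z i + w i) ^ 2 ≤ ∑ i, z i ^ 2}
      ≤ ∏ i, ENNReal.ofReal (Real.exp (-(w i ^ 2 / (8 * v)))) := by
  set gain : (ι → ℝ) → ℝ≥0∞ := fun z =>
    ∏ i, ENNReal.ofReal (Real.exp ((z i ^ 2 - (z i + w i) ^ 2) / (4 * v)))
  calc gaussianNoise ι v {z | ∑ i, (z i + w i) ^ 2 ≤ ∑ i, z i ^ 2}
      ≤ gaussianNoise ι v {z | 1 ≤ gain z} := by
        refine measure_mono fun z (hz : ∑ i, (z i + w i) ^ 2 ≤ ∑ i, z i ^ 2) => ?_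
        simp only [Set.mem_ofPred_eq, gain]
        rw [← ENNReal.ofReal_prod_of_nonneg fun _ _ => (Real.exp_pos _).le,
          ← Real.exp_sum, ENNReal.one_le_ofReal, ← Finset.sum_div, Finset.sum_sub_distrib]
        exact Real.one_le_exp (div_nonneg (sub_nonneg.mpr hz) (by positivity))
    _ ≤ ∫⁻ z, gain z ∂gaussianNoise ι v := by
        simpa using mul_meas_ge_le_lintegral (μ := gaussianNoise ι v) (f := gain)
          (by fun_prop) 1
    _ = _ := by
        rw [lintegral_pi_prod _ (f := fun i z =>
          ENNReal.ofReal (Real.exp ((z ^ 2 - (z + w i) ^ 2) / (4 * v)))) fun i => by fun_prop]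
        simp_rw [lintegral_exp_neg_noise_gain hv]

theorem prod_gaussianNoise_norm_add_le (μ : Measure 𝒳) {v : ℝ≥0} (hv : v ≠ 0)
    {f : 𝒳 → ι → ℝ} (hf : Measurable f) :
    μ.prod (gaussianNoise ι v) {t | ∑ i, (t.2 i + f t.1 i) ^ 2 ≤ ∑ i, t.2 i ^ 2}
      ≤ ∫⁻ x, ∏ i, ENNReal.ofReal (Real.exp (-(f x i ^ 2 / (8 * v)))) ∂μ := by
  rw [Measure.prod_apply (measurableSet_le (by fun_prop) (by fun_prop))]
  exact lintegral_mono fun x => gaussianNoise_norm_add_le hv (f x)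

/-- The density of `gaussianReal c v` with respect to `gaussianReal 0 V`, for positive variances:
the likelihood ratio in the change of measure to an output law free of the codeword. -/
def gaussianRatio (v V : ℝ≥0) (c y : ℝ) : ℝ≥0∞ :=
  ENNReal.ofReal (√(V / v) * Real.exp (-(y - c) ^ 2 / (2 * v) + y ^ 2 / (2 * V)))

theorem measurable_gaussianRatio (v V : ℝ≥0) (c : ℝ) : Measurable (gaussianRatio v V c) := by
  unfold gaussianRatio
  fun_prop

theorem gaussianReal_withDensity_gaussianRatio {v V : ℝ≥0} (hv : v ≠ 0) (hV : V ≠ 0) (c : ℝ) :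
    (gaussianReal 0 V).withDensity (gaussianRatio v V c) = gaussianReal c v := by
  have : (0 : ℝ) < v := by positivity
  have : (0 : ℝ) < V := by positivity
  rw [gaussianReal_of_var_ne_zero _ hv, gaussianReal_of_var_ne_zero _ hV,
    ← withDensity_mul _ (measurable_gaussianPDF _ _) (measurable_gaussianRatio _ _ _)]
  congr 1
  ext y
  simp only [Pi.mul_apply, gaussianPDF, gaussianPDFReal, gaussianRatio]
  rw [← ENNReal.ofReal_mul (by positivity), mul_mul_mul_comm, ← Real.exp_add]
  congr 2
  · rw [← Real.sqrt_inv, ← Real.sqrt_inv, ← Real.sqrt_mul (by positivity)]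
    congr 1
    field_simp
  · congr 1
    field_simp
    ring

theorem gaussianRatio_le (v V : ℝ≥0) (c y : ℝ) :
    gaussianRatio v V c y ≤ ENNReal.ofReal (√(V / v) * Real.exp (y ^ 2 / (2 * V))) := by
  unfold gaussianRatio
  gcongr
  have : 0 ≤ (y - c) ^ 2 / (2 * (v : ℝ)) := by positivity
  rw [neg_div]
  linarith

theorem prod_gaussianRatio_le (v V : ℝ≥0) (c y : ι → ℝ) :
    ∏ i, gaussianRatio v V (c i) (y i)
      ≤ ENNReal.ofReal (√(V / v) ^ Fintype.card ι * Real.exp ((∑ i, y i ^ 2) / (2 * V))) :=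
  calc _ ≤ ∏ i, ENNReal.ofReal (√(V / v) * Real.exp (y i ^ 2 / (2 * V))) :=
        Finset.prod_le_prod' fun i _ => gaussianRatio_le _ _ _ _
    _ = _ := by
        rw [← ENNReal.ofReal_prod_of_nonneg (fun _ _ => by positivity), Finset.prod_mul_distrib,
          Finset.prod_const, Finset.card_univ, ← Real.exp_sum, Finset.sum_div]

theorem pi_gaussianReal_eq_withDensity {v V : ℝ≥0} (hv : v ≠ 0) (hV : V ≠ 0) (c : ι → ℝ) :
    Measure.pi (fun i => gaussianReal (c i) v)
      = (gaussianNoise ι V).withDensity fun y => ∏ i, gaussianRatio v V (c i) (y i) := by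
  have : ∀ i, SigmaFinite ((gaussianReal 0 V).withDensity (gaussianRatio v V (c i))) := by
    intro i
    rw [gaussianReal_withDensity_gaussianRatio hv hV]
    infer_instance
  rw [← pi_withDensity _ fun i => measurable_gaussianRatio v V (c i)]
  simp_rw [gaussianReal_withDensity_gaussianRatio hv hV]

theorem pi_gaussianReal_inter_ball_le {v V : ℝ≥0} (hv : v ≠ 0) (hV : V ≠ 0) (c : ι → ℝ) (R : ℝ)
    {A : Set (ι → ℝ)} (hA : MeasurableSet A) :
    Measure.pi (fun i => gaussianReal (c i) v) (A ∩ {y | ∑ i, y i ^ 2 ≤ R})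
      ≤ ENNReal.ofReal (√(V / v) ^ Fintype.card ι * Real.exp (R / (2 * V)))
        * gaussianNoise ι V A := by
  have hball : MeasurableSet {y : ι → ℝ | ∑ i, y i ^ 2 ≤ R} :=
    measurableSet_le (by fun_prop) (by fun_prop)
  rw [pi_gaussianReal_eq_withDensity hv hV, withDensity_apply _ (hA.inter hball)]
  calc _ ≤ ∫⁻ _ in A ∩ {y | ∑ i, y i ^ 2 ≤ R},
        ENNReal.ofReal (√(V / v) ^ Fintype.card ι * Real.exp (R / (2 * V)))
          ∂gaussianNoise ι V := by
        refine setLIntegral_mono (by fun_prop) fun y ⟨_, (hy : ∑ i, y i ^ 2 ≤ R)⟩ => ?_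
        refine (prod_gaussianRatio_le v V c y).trans ?_
        gcongr
    _ ≤ _ := by
        rw [setLIntegral_const]
        gcongr
        exact Set.inter_subset_left

theorem gaussianNoise_map_const_add (v : ℝ≥0) (c : ι → ℝ) :
    (gaussianNoise ι v).map (fun z => c + z) = Measure.pi fun i => gaussianReal (c i) v := by
  have h := Measure.pi_map_pi (μ := fun _ : ι => gaussianReal 0 v) (f := fun i z => c i + z)
    fun i => by fun_prop
  simp only [gaussianReal_map_const_add, zero_add] at h
  exact h

theorem gaussianChannel_inter_ball_le (μ : Measure 𝒳) [SFinite μ] {v V : ℝ≥0} (hv : v ≠ 0)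
    (hV : V ≠ 0) {f : 𝒳 → ι → ℝ} (hf : Measurable f) (R : ℝ) {A : Set (𝒳 × (ι → ℝ))}
    (hA : MeasurableSet A) :
    gaussianChannel μ v f (A ∩ {t | ∑ i, t.2 i ^ 2 ≤ R})
      ≤ ENNReal.ofReal (√(V / v) ^ Fintype.card ι * Real.exp (R / (2 * V)))
        * μ.prod (gaussianNoise ι V) A := by
  have hAR : MeasurableSet (A ∩ {t | ∑ i, t.2 i ^ 2 ≤ R}) :=
    hA.inter (measurableSet_le (by fun_prop) (by fun_prop))
  have hout : Measurable fun t : 𝒳 × (ι → ℝ) => (t.1, f t.1 + t.2) := by fun_prop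
  rw [gaussianChannel, Measure.map_apply hout hAR, Measure.prod_apply (hout hAR),
    Measure.prod_apply hA,
    ← lintegral_const_mul' _ _ ENNReal.ofReal_ne_top]
  refine lintegral_mono fun x => ?_
  have hslice := pi_gaussianReal_inter_ball_le hv hV (f x) R (measurable_prodMk_left (x := x) hA)
  rw [← gaussianNoise_map_const_add] at hslice
  exact (Measure.map_apply (by fun_prop) (measurable_prodMk_left hAR)).symm.trans_le hslice

theorem lintegral_sum_sq_gaussianChannel (μ : Measure 𝒳) [IsProbabilityMeasure μ] (v : ℝ≥0)
    {f : 𝒳 → ι → ℝ} (hf : Measurable f) :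
    ∫⁻ t, ENNReal.ofReal (∑ i, t.2 i ^ 2) ∂gaussianChannel μ v f
      = ∫⁻ x, ENNReal.ofReal (∑ i, f x i ^ 2) ∂μ + Fintype.card ι * v := by
  have hnoise : ∀ x, ∫⁻ z, ENNReal.ofReal (∑ i, (f x i + z i) ^ 2) ∂gaussianNoise ι v
      = ENNReal.ofReal (∑ i, f x i ^ 2) + Fintype.card ι * v := by
    intro x
    simp_rw [ENNReal.ofReal_sum_of_nonneg fun _ _ => sq_nonneg _]
    rw [lintegral_finsetSum _ (by fun_prop)]
    simp_rw [fun i => (measurePreserving_eval (fun _ : ι => gaussianReal 0 v) i).lintegral_comp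
      (f := fun y => ENNReal.ofReal ((f x i + y) ^ 2)) (by fun_prop),
      lintegral_const_add_sq_gaussianReal, Finset.sum_add_distrib]
    simp
  rw [gaussianChannel, lintegral_map (by fun_prop) (by fun_prop),
    lintegral_prod _ (by fun_prop)]
  simp only [Pi.add_apply, hnoise]
  rw [lintegral_add_right _ measurable_const]
  simp

theorem gaussianChannel_ball_compl_le (μ : Measure 𝒳) [IsProbabilityMeasure μ] {v w : ℝ≥0}
    (hv : v ≠ 0) {f : 𝒳 → ι → ℝ} (hf : Measurable f)
    (hpower : ∫⁻ x, ENNReal.ofReal (∑ i, f x i ^ 2) ∂μ ≤ Fintype.card ι * w) :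
    gaussianChannel μ v f {t | ∑ i, t.2 i ^ 2 ≤ 2 * Fintype.card ι * (v + w)}ᶜ ≤ 2⁻¹ := by
  rcases isEmpty_or_nonempty ι with _ | _
  · simp
  have : (0 : ℝ) < v := by positivity
  have : (0 : ℝ) < Fintype.card ι := by exact_mod_cast Fintype.card_pos
  set R : ℝ := 2 * Fintype.card ι * (v + w) with hR
  have hRpos : 0 < R := by positivity
  have hhalf : ENNReal.ofReal (R / 2) = Fintype.card ι * w + Fintype.card ι * v := by
    rw [show R / 2 = (Fintype.card ι * w + Fintype.card ι * v : ℝ≥0) by rw [hR]; push_cast; ring,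
      ENNReal.ofReal_coe_nnreal]
    push_cast
    rfl
  calc gaussianChannel μ v f {t | ∑ i, t.2 i ^ 2 ≤ R}ᶜ
      ≤ gaussianChannel μ v f {t | ENNReal.ofReal R ≤ ENNReal.ofReal (∑ i, t.2 i ^ 2)} :=
        measure_mono fun t ht =>
          ENNReal.ofReal_le_ofReal (not_le.mp (Set.notMem_ofPred_iff.mp ht)).le
    _ ≤ (∫⁻ t, ENNReal.ofReal (∑ i, t.2 i ^ 2) ∂gaussianChannel μ v f) / ENNReal.ofReal R :=
        meas_ge_le_lintegral_div (by fun_prop) (by simpa using hRpos) ENNReal.ofReal_ne_top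
    _ ≤ ENNReal.ofReal (R / 2) / ENNReal.ofReal R := by
        rw [lintegral_sum_sq_gaussianChannel μ v hf, hhalf]
        gcongr
    _ = 2⁻¹ := by
        rw [← ENNReal.ofReal_div_of_pos hRpos, div_right_comm, div_self hRpos.ne', one_div,
          ENNReal.ofReal_inv_of_pos two_pos, ENNReal.ofReal_ofNat]

theorem one_le_gaussianChannel_error_add {κ : Type*} [MeasurableSpace κ]
    [MeasurableSingletonClass κ] (μ : Measure 𝒳) [IsProbabilityMeasure μ] {v w : ℝ≥0}
    (hv : v ≠ 0) {f : 𝒳 → ι → ℝ} (hf : Measurable f)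
    (hpower : ∫⁻ x, ENNReal.ofReal (∑ i, f x i ^ 2) ∂μ ≤ Fintype.card ι * w)
    {g : 𝒳 × (ι → ℝ) → κ} (hg : Measurable g) (a : κ) :
    1 ≤ gaussianChannel μ v f {t | g t ≠ a} + 2⁻¹
      + ENNReal.ofReal ((Real.exp 1 * √(1 + w / v)) ^ Fintype.card ι)
        * μ.prod (gaussianNoise ι (v + w)) (g ⁻¹' {a}) := by
  have := isProbabilityMeasure_gaussianChannel μ v hf
  have : (0 : ℝ) < v := by positivity
  set ball : Set (𝒳 × (ι → ℝ)) := {t | ∑ i, t.2 i ^ 2 ≤ 2 * Fintype.card ι * (v + w)}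
  have hcover : Set.univ ⊆ {t | g t ≠ a} ∪ ballᶜ ∪ (g ⁻¹' {a} ∩ ball) := by
    intro t _
    by_cases ht : g t = a <;> by_cases ht' : t ∈ ball <;> simp [ht, ht']
  have hratio : √((v + w : ℝ≥0) / v) ^ Fintype.card ι
        * Real.exp (2 * Fintype.card ι * (v + w) / (2 * (v + w : ℝ≥0)))
      = (Real.exp 1 * √(1 + w / v)) ^ Fintype.card ι := by
    rw [mul_pow, mul_comm, ← Real.exp_nat_mul]
    congr 3 <;> push_cast <;> field_simp
  calc (1 : ℝ≥0∞) = gaussianChannel μ v f Set.univ := measure_univ.symm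
    _ ≤ gaussianChannel μ v f {t | g t ≠ a} + gaussianChannel μ v f ballᶜ
        + gaussianChannel μ v f (g ⁻¹' {a} ∩ ball) :=
        (measure_mono hcover).trans <| (measure_union_le _ _).trans <|
          add_le_add_left (measure_union_le _ _) _
    _ ≤ _ := by
        rw [← hratio]
        gcongr
        · exact gaussianChannel_ball_compl_le μ hv hf hpower
        · exact gaussianChannel_inter_ball_le μ hv (by positivity) hf _
            (hg (measurableSet_singleton a))

-- Under the common dominating law the decoding regions are disjoint, so their masses add up to
-- at most one however many codewords there are.
theorem card_le_sum_gaussianChannel_error_add {κ : Type*} [MeasurableSpace κ]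
    [MeasurableSingletonClass κ] (μ : Measure 𝒳) [IsProbabilityMeasure μ] {v w : ℝ≥0}
    (hv : v ≠ 0) {f : κ → 𝒳 → ι → ℝ} (hf : ∀ a, Measurable (f a)) (𝒮 : Finset κ)
    (hpower : ∀ a ∈ 𝒮, ∫⁻ x, ENNReal.ofReal (∑ i, f a x i ^ 2) ∂μ ≤ Fintype.card ι * w)
    {g : 𝒳 × (ι → ℝ) → κ} (hg : Measurable g) :
    (𝒮.card : ℝ≥0∞) ≤ ∑ a ∈ 𝒮, (gaussianChannel μ v (f a) {t | g t ≠ a} + 2⁻¹)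
      + ENNReal.ofReal ((Real.exp 1 * √(1 + w / v)) ^ Fintype.card ι) := by
  set K := ENNReal.ofReal ((Real.exp 1 * √(1 + w / v)) ^ Fintype.card ι)
  set Q := μ.prod (gaussianNoise ι (v + w))
  calc (𝒮.card : ℝ≥0∞) = ∑ _a ∈ 𝒮, 1 := by simp
    _ ≤ ∑ a ∈ 𝒮, (gaussianChannel μ v (f a) {t | g t ≠ a} + 2⁻¹ + K * Q (g ⁻¹' {a})) :=
        Finset.sum_le_sum fun a ha =>
          one_le_gaussianChannel_error_add μ hv (hf a) (hpower a ha) hg a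
    _ = ∑ a ∈ 𝒮, (gaussianChannel μ v (f a) {t | g t ≠ a} + 2⁻¹) + K * Q (g ⁻¹' 𝒮) := by
        rw [Finset.sum_add_distrib, ← Finset.mul_sum,
          sum_measure_preimage_singleton _ fun a _ => hg (measurableSet_singleton a)]
    _ ≤ _ := by
        gcongr
        exact mul_le_of_le_one_right' prob_le_one

end GaussianChannel

section SparseDesign

section LinearForm

variable {ι : Type*} [Fintype ι] (ν : ι → Measure ℝ) [∀ j, IsProbabilityMeasure (ν j)]

theorem charFun_map_linear_pi (u : ι → ℝ) (t : ℝ) :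
    charFun ((Measure.pi ν).map fun x => ∑ j, x j * u j) t = ∏ j, charFun (ν j) (t * u j) := by
  have hfactor : ∀ x : ι → ℝ, Complex.exp (t * (∑ j, x j * u j : ℝ) * Complex.I)
      = ∏ j, Complex.exp ((t * u j : ℝ) * x j * Complex.I) := by
    intro x
    rw [← Complex.exp_sum, Complex.ofReal_sum, Finset.mul_sum, Finset.sum_mul]
    congr 1
    refine Finset.sum_congr rfl fun j _ => ?_
    push_cast
    ring
  have hlin : Measurable fun x : ι → ℝ => ∑ j, x j * u j := by fun_prop
  rw [charFun_apply_real, integral_map hlin.aemeasurable (by fun_prop)]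
  simp_rw [hfactor, charFun_apply_real]
  exact integral_fintype_prod_eq_prod (𝕜 := ℂ)
    fun j (y : ℝ) => Complex.exp ((t * u j : ℝ) * y * Complex.I)

-- The left-hand side integrates the characteristic function of a centred Gaussian variable of
-- variance `v` against the law of the linear form, so the two laws may be exchanged.
theorem integral_exp_neg_sq_linear_pi (v : ℝ≥0) (u : ι → ℝ) :
    ∫ x, Complex.exp (-(v * (∑ j, x j * u j : ℝ) ^ 2 / 2)) ∂Measure.pi ν
      = ∫ g, ∏ j, charFun (ν j) (g * u j) ∂gaussianReal 0 v := by
  have hlin : Measurable fun x : ι → ℝ => ∑ j, x j * u j := by fun_prop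
  have := Measure.isProbabilityMeasure_map (μ := Measure.pi ν) hlin.aemeasurable
  simp_rw [← charFun_map_linear_pi]
  rw [integral_charFun_comm, integral_map hlin.aemeasurable (by fun_prop)]
  simp [charFun_gaussianReal]

theorem lintegral_sq_linear_pi {q : ℝ} (hmem : ∀ j, MemLp id 2 (ν j))
    (hmean : ∀ j, ∫ y, id y ∂ν j = 0) (hvar : ∀ j, Var[id; ν j] = q) (u : ι → ℝ) :
    ∫⁻ x, ENNReal.ofReal ((∑ j, x j * u j) ^ 2) ∂Measure.pi ν
      = ENNReal.ofReal (q * ∑ j, u j ^ 2) := by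
  have hcoord : ∀ j, MemLp (fun y => y * u j) 2 (ν j) := fun j => (hmem j).mul_const (u j)
  have hcoord' : ∀ j, MemLp (fun x : ι → ℝ => x j * u j) 2 (Measure.pi ν) := fun j =>
    (hcoord j).comp_measurePreserving (measurePreserving_eval ν j)
  have hlin : MemLp (∑ j, fun x : ι → ℝ => x j * u j) 2 (Measure.pi ν) :=
    memLp_finsetSum' _ fun j _ => hcoord' j
  have hmean_lin : (Measure.pi ν)[∑ j, fun x : ι → ℝ => x j * u j] = 0 := by
    simp_rw [Finset.sum_apply]
    rw [integral_finsetSum _ fun j _ => (hcoord' j).integrable one_le_two]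
    refine Finset.sum_eq_zero fun j _ => ?_
    rw [integral_comp_eval (μ := ν) (f := fun y => y * u j) (by fun_prop), integral_mul_const]
    simpa using Or.inl (hmean j)
  have hvar_lin : Var[∑ j, fun x : ι → ℝ => x j * u j; Measure.pi ν] = q * ∑ j, u j ^ 2 := by
    rw [variance_sum_pi (X := fun j y => y * u j) hcoord, Finset.mul_sum]
    exact Finset.sum_congr rfl fun j _ => by
      rw [← hvar j]
      exact variance_mul_const (u j) id (ν j)
  rw [← hvar_lin, ofReal_variance hlin, evariance_eq_lintegral_ofReal, hmean_lin]
  simp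

end LinearForm

/-- The law of a sparse Gaussian entry: the product of a Bernoulli variable of mean `q` and an
independent standard Gaussian variable. -/
def sparseEntryLaw (q : unitInterval) : Measure ℝ :=
  ((bernoulliMeasure 1 0 q).prod (gaussianReal 0 1)).map fun x => x.1 * x.2

instance (q : unitInterval) : IsProbabilityMeasure (sparseEntryLaw q) :=
  Measure.isProbabilityMeasure_map (by fun_prop)

theorem sparseEntryLaw_eq_mixture (q : unitInterval) :
    sparseEntryLaw q = unitInterval.toNNReal q • gaussianReal 0 1
      + unitInterval.toNNReal (unitInterval.symm q) • Measure.dirac 0 := by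
  rw [sparseEntryLaw, bernoulliMeasure_def, Measure.add_prod, Measure.prod_smul_left,
    Measure.prod_smul_left, Measure.dirac_prod, Measure.dirac_prod,
    Measure.map_add _ _ (by fun_prop), Measure.map_smul, Measure.map_smul,
    Measure.map_map (by fun_prop) (by fun_prop), Measure.map_map (by fun_prop) (by fun_prop)]
  simp [Function.comp_def]

theorem integrable_sparseEntryLaw {E : Type*} [NormedAddCommGroup E] (q : unitInterval)
    {f : ℝ → E} (hf : Integrable f (gaussianReal 0 1)) : Integrable f (sparseEntryLaw q) := by
  rw [sparseEntryLaw_eq_mixture]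
  exact hf.smul_measure_nnreal.add_measure (integrable_dirac (by simp)).smul_measure_nnreal

theorem integral_sparseEntryLaw {E : Type*} [NormedAddCommGroup E] [NormedSpace ℝ E]
    [CompleteSpace E] (q : unitInterval) {f : ℝ → E} (hf : Integrable f (gaussianReal 0 1)) :
    ∫ x, f x ∂sparseEntryLaw q = (q : ℝ) • ∫ x, f x ∂gaussianReal 0 1 + (1 - q : ℝ) • f 0 := by
  rw [sparseEntryLaw_eq_mixture, integral_add_measure hf.smul_measure_nnreal
    (integrable_dirac (by simp)).smul_measure_nnreal]
  simp [NNReal.smul_def]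

theorem charFun_sparseEntryLaw (q : unitInterval) (t : ℝ) :
    charFun (sparseEntryLaw q) t = (1 - q + q * Real.exp (-(t ^ 2 / 2)) : ℝ) := by
  have hint : Integrable (fun x : ℝ => Complex.exp (t * x * Complex.I)) (gaussianReal 0 1) := by
    refine Integrable.of_bound (by fun_prop) 1 (ae_of_all _ fun x => ?_)
    rw [← Complex.ofReal_mul, Complex.norm_exp_ofReal_mul_I]
  rw [charFun_apply_real, integral_sparseEntryLaw q hint, ← charFun_apply_real,
    charFun_gaussianReal]
  simp
  ring

theorem memLp_id_sparseEntryLaw (q : unitInterval) : MemLp id 2 (sparseEntryLaw q) :=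
  (memLp_two_iff_integrable_sq (by fun_prop)).mpr <|
    integrable_sparseEntryLaw q (memLp_id_gaussianReal 2).integrable_sq

theorem integral_id_sparseEntryLaw (q : unitInterval) : ∫ x, id x ∂sparseEntryLaw q = 0 := by
  rw [integral_sparseEntryLaw q ((memLp_id_gaussianReal 2).integrable (by norm_num))]
  simp

theorem variance_id_sparseEntryLaw (q : unitInterval) : Var[id; sparseEntryLaw q] = q := by
  have hgaussian : ∫ x, id x ^ 2 ∂gaussianReal 0 1 = 1 := by
    rw [← variance_of_integral_eq_zero (by fun_prop) (by simp), variance_id_gaussianReal,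
      NNReal.coe_one]
  rw [variance_of_integral_eq_zero (by fun_prop) (integral_id_sparseEntryLaw q),
    integral_sparseEntryLaw q (memLp_id_gaussianReal 2).integrable_sq, hgaussian]
  simp

theorem min_div_two_le_one_sub_exp_neg {y : ℝ} (hy : 0 ≤ y) :
    min y 1 / 2 ≤ 1 - Real.exp (-y) := by
  have hexp : Real.exp (-y) ≤ (1 + y)⁻¹ := by
    rw [Real.exp_neg]
    exact inv_anti₀ (by positivity) (by linarith [Real.add_one_le_exp y])
  have hmin : min y 1 / 2 ≤ 1 - (1 + y)⁻¹ := by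
    rw [show 1 - (1 + y)⁻¹ = y / (1 + y) by field_simp; ring,
      div_le_div_iff₀ two_pos (by positivity)]
    rcases min_choice y 1 with h | h <;> rw [h] <;> nlinarith [min_le_left y 1, min_le_right y 1]
  linarith

theorem one_sub_add_mul_exp_nonneg (q : unitInterval) (y : ℝ) :
    0 ≤ 1 - q + q * Real.exp y :=
  add_nonneg (sub_nonneg.mpr q.2.2) (mul_nonneg q.2.1 (Real.exp_pos _).le)

theorem one_sub_add_mul_exp_le_one (q : unitInterval) {y : ℝ} (hy : y ≤ 0) :
    1 - q + q * Real.exp y ≤ 1 := by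
  nlinarith [q.2.1, Real.exp_le_one_iff.mpr hy]

theorem one_sub_add_mul_exp_neg_pow_le (q : unitInterval) {y : ℝ} (hy : 0 ≤ y) (m : ℕ) :
    (1 - q + q * Real.exp (-y)) ^ m
      ≤ Real.exp (-(m * q / 2 * y)) + Real.exp (-(m * q / 2)) := by
  have := q.2.1
  have hbase : 1 - q + q * Real.exp (-y) ≤ Real.exp (-(q * (min y 1 / 2))) :=
    calc 1 - q + q * Real.exp (-y) = -(q * (1 - Real.exp (-y))) + 1 := by ring
      _ ≤ -(q * (min y 1 / 2)) + 1 := by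
        gcongr
        exact min_div_two_le_one_sub_exp_neg hy
      _ ≤ _ := Real.add_one_le_exp _
  calc _ ≤ Real.exp (-(m * q / 2 * min y 1)) := by
        refine (pow_le_pow_left₀ (one_sub_add_mul_exp_nonneg q _) hbase m).trans_eq ?_
        rw [← Real.exp_nat_mul]
        congr 1
        ring
    _ ≤ _ := by
        rcases min_choice y 1 with h | h <;> rw [h]
        · exact le_add_of_nonneg_right (Real.exp_pos _).le
        · rw [mul_one]
          exact le_add_of_nonneg_left (Real.exp_pos _).le

theorem prod_sparse_factor_le {p m : ℕ} {u : Fin p → ℝ} (hu : u ∈ signalClass p m)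
    (q : unitInterval) (g : ℝ) :
    ∏ j, (1 - q + q * Real.exp (-((g * u j) ^ 2 / 2)))
      ≤ Real.exp (-(m * q / 4 * g ^ 2)) + Real.exp (-(m * q / 2)) := by
  calc ∏ j, (1 - q + q * Real.exp (-((g * u j) ^ 2 / 2)))
      = ∏ j ∈ supp u, (1 - q + q * Real.exp (-((g * u j) ^ 2 / 2))) := by
        refine (Finset.prod_subset (Finset.subset_univ _) fun j _ hj => ?_).symm
        simp [show u j = 0 by simpa [supp] using hj]
    _ ≤ ∏ _j ∈ supp u, (1 - q + q * Real.exp (-(g ^ 2 / 2))) := by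
        refine Finset.prod_le_prod (fun j _ => one_sub_add_mul_exp_nonneg q _) fun j hj => ?_
        have hsq : g ^ 2 ≤ (g * u j) ^ 2 := by
          rw [mul_pow]
          exact le_mul_of_one_le_right (sq_nonneg g)
            ((one_le_sq_iff_one_le_abs _).mpr (hu.2 j hj))
        have := q.2.1
        gcongr 1 - (q : ℝ) + q * Real.exp (-(?_ / 2))
    _ ≤ _ := by
        rw [Finset.prod_const, hu.1]
        refine (one_sub_add_mul_exp_neg_pow_le q (by positivity) m).trans_eq ?_
        congr 2
        ring

theorem lintegral_exp_neg_sq_sparseEntryLaw {p : ℕ} (q : unitInterval) (v : ℝ≥0)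
    (u : Fin p → ℝ) :
    ∫⁻ x, ENNReal.ofReal (Real.exp (-(v * (∑ j, x j * u j) ^ 2 / 2)))
        ∂Measure.pi (fun _ => sparseEntryLaw q)
      = ∫⁻ g, ENNReal.ofReal (∏ j, (1 - q + q * Real.exp (-((g * u j) ^ 2 / 2))))
        ∂gaussianReal 0 v := by
  have hparseval : ∫ x, Real.exp (-(v * (∑ j, x j * u j) ^ 2 / 2))
        ∂Measure.pi (fun _ => sparseEntryLaw q)
      = ∫ g, ∏ j, (1 - q + q * Real.exp (-((g * u j) ^ 2 / 2))) ∂gaussianReal 0 v := by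
    have hcomplex := integral_exp_neg_sq_linear_pi (fun _ => sparseEntryLaw q) v u
    simp_rw [charFun_sparseEntryLaw] at hcomplex
    exact_mod_cast hcomplex
  rw [← ofReal_integral_eq_lintegral_ofReal _ (ae_of_all _ fun _ => (Real.exp_pos _).le),
    hparseval, ofReal_integral_eq_lintegral_ofReal _ (ae_of_all _ fun _ =>
      Finset.prod_nonneg fun _ _ => one_sub_add_mul_exp_nonneg q _)]
  · refine Integrable.of_bound (by fun_prop) 1 (ae_of_all _ fun g => ?_)
    rw [Real.norm_of_nonneg (Finset.prod_nonneg fun _ _ => one_sub_add_mul_exp_nonneg q _)]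
    exact Finset.prod_le_one (fun _ _ => one_sub_add_mul_exp_nonneg q _) fun j _ =>
      one_sub_add_mul_exp_le_one q (neg_nonpos.mpr (by positivity))
  · refine Integrable.of_bound (Measurable.aestronglyMeasurable (by fun_prop)) 1
      (ae_of_all _ fun x => ?_)
    rw [Real.norm_of_nonneg (Real.exp_pos _).le, Real.exp_le_one_iff, neg_nonpos]
    positivity

theorem lintegral_exp_neg_sq_sparseEntryLaw_le {p m : ℕ} {u : Fin p → ℝ}
    (hu : u ∈ signalClass p m) (q : unitInterval) (v : ℝ≥0) :
    ∫⁻ x, ENNReal.ofReal (Real.exp (-(v * (∑ j, x j * u j) ^ 2 / 2)))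
        ∂Measure.pi (fun _ => sparseEntryLaw q)
      ≤ ENNReal.ofReal ((√(1 + m * q * v / 2))⁻¹ + Real.exp (-(m * q / 2))) := by
  have := q.2.1
  rw [lintegral_exp_neg_sq_sparseEntryLaw]
  calc _ ≤ ∫⁻ g, (ENNReal.ofReal (Real.exp (-(m * q / 4 * g ^ 2)))
          + ENNReal.ofReal (Real.exp (-(m * q / 2)))) ∂gaussianReal 0 v := by
        refine lintegral_mono fun g => ?_
        rw [← ENNReal.ofReal_add (Real.exp_pos _).le (Real.exp_pos _).le]
        exact ENNReal.ofReal_le_ofReal (prod_sparse_factor_le hu q g)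
    _ = _ := by
        rw [lintegral_add_right _ measurable_const,
          lintegral_exp_neg_mul_sq_gaussianReal v (by positivity), lintegral_const, measure_univ,
          mul_one, ← ENNReal.ofReal_add (by positivity) (by positivity)]
        congr 5
        ring

/-- The law of an `n × p` matrix with independent sparse Gaussian entries. -/
def sparseDesignLaw (n p : ℕ) (q : unitInterval) : Measure (Fin n → Fin p → ℝ) :=
  Measure.pi fun _ => Measure.pi fun _ => sparseEntryLaw q

instance (n p : ℕ) (q : unitInterval) : IsProbabilityMeasure (sparseDesignLaw n p q) := by
  unfold sparseDesignLaw
  infer_instance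

theorem lintegral_sum_sq_sparseDesignLaw {n p : ℕ} (q : unitInterval) (u : Fin p → ℝ) :
    ∫⁻ X, ENNReal.ofReal (∑ i, (∑ j, X i j * u j) ^ 2) ∂sparseDesignLaw n p q
      = n * ENNReal.ofReal (q * ∑ j, u j ^ 2) := by
  simp_rw [ENNReal.ofReal_sum_of_nonneg fun _ _ => sq_nonneg _, sparseDesignLaw]
  rw [lintegral_finsetSum _ (by fun_prop)]
  simp_rw [fun i => (measurePreserving_eval (fun _ : Fin n => Measure.pi fun _ : Fin p =>
      sparseEntryLaw q) i).lintegral_comp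
      (f := fun x => ENNReal.ofReal ((∑ j, x j * u j) ^ 2)) (by fun_prop),
    lintegral_sq_linear_pi _ (fun _ => memLp_id_sparseEntryLaw q)
      (fun _ => integral_id_sparseEntryLaw q) (fun _ => variance_id_sparseEntryLaw q)]
  simp

theorem sparseDesignLaw_prod_residual_le {n p m : ℕ} (q : unitInterval) {v : ℝ≥0} (hv : v ≠ 0)
    {u : Fin p → ℝ} (hu : u ∈ signalClass p m) :
    (sparseDesignLaw n p q).prod (gaussianNoise (Fin n) v)
        {t | ∑ i, (t.2 i + ∑ j, t.1 i j * u j) ^ 2 ≤ ∑ i, t.2 i ^ 2}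
      ≤ ENNReal.ofReal ((√(1 + m * q / (8 * v)))⁻¹ + Real.exp (-(m * q / 2))) ^ n := by
  have hscale : ∀ W : ℝ, W ^ 2 / (8 * v) = ((4 * v)⁻¹ : ℝ≥0) * W ^ 2 / 2 := by
    intro W
    push_cast
    field_simp
    ring
  calc _ ≤ ∫⁻ X, ∏ i, ENNReal.ofReal (Real.exp (-((∑ j, X i j * u j) ^ 2 / (8 * v))))
          ∂sparseDesignLaw n p q :=
        prod_gaussianNoise_norm_add_le (sparseDesignLaw n p q) hv
          (f := fun X i => ∑ j, X i j * u j) (by fun_prop)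
    _ = ∏ _i : Fin n, ∫⁻ x, ENNReal.ofReal (Real.exp
          (-(((4 * v)⁻¹ : ℝ≥0) * (∑ j, x j * u j) ^ 2 / 2)))
          ∂Measure.pi (fun _ => sparseEntryLaw q) := by
        simp_rw [hscale]
        exact lintegral_pi_prod (fun _ => Measure.pi fun _ => sparseEntryLaw q)
          (f := fun _ x => ENNReal.ofReal (Real.exp
            (-(((4 * v)⁻¹ : ℝ≥0) * (∑ j, x j * u j) ^ 2 / 2)))) fun _ => by fun_prop
    _ ≤ _ := by
        rw [Finset.prod_const, Finset.card_univ, Fintype.card_fin]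
        gcongr
        refine (lintegral_exp_neg_sq_sparseEntryLaw_le hu q _).trans_eq ?_
        congr 5
        push_cast
        field_simp
        ring

end SparseDesign

section Model

theorem measurePreserving_curry_pi {ι κ : Type*} [Fintype ι] [Fintype κ] {E : Type*}
    [MeasurableSpace E] (ν : Measure E) [IsProbabilityMeasure ν] :
    MeasurePreserving (MeasurableEquiv.curry ι κ E) (Measure.pi fun _ => ν)
      (Measure.pi fun _ => Measure.pi fun _ => ν) := by
  have hcurry := Measure.infinitePi_map_curry (fun (_ : ι) (_ : κ) => ν)
  simp only [Measure.infinitePi_eq_pi] at hcurry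
  exact ⟨by fun_prop, hcurry⟩

theorem measurePreserving_sparse_mul (ι : Type*) [Fintype ι] (q : unitInterval) :
    MeasurePreserving (fun x : (ι → ℝ) × (ι → ℝ) => fun i => x.1 i * x.2 i)
      ((Measure.pi fun _ => bernoulliMeasure 1 0 q).prod (Measure.pi fun _ => gaussianReal 0 1))
      (Measure.pi fun _ => sparseEntryLaw q) :=
  (measurePreserving_pi _ _ fun _ => (⟨by fun_prop, rfl⟩ : MeasurePreserving
      (fun x : ℝ × ℝ => x.1 * x.2) ((bernoulliMeasure 1 0 q).prod (gaussianReal 0 1))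
      (sparseEntryLaw q))).comp
    (measurePreserving_arrowProdEquivProdArrow ℝ ℝ ι _ _).symm

variable {Ω : Type*} [MeasurableSpace Ω] {P : Measure Ω} {n p s d : ℕ} {hdp : d ≤ p} {σ : ℝ}
  {B N : Fin n → Fin p → Ω → ℝ} {Z : Fin n → Ω → ℝ}

theorem IsSparseGaussianModel.hasLaw (h : IsSparseGaussianModel P d hdp σ B N Z) :
    HasLaw (fun ω => ((fun i j => B i j ω * N i j ω), fun i => Z i ω))
      ((sparseDesignLaw n p (densityRate d p hdp)).prod
        (gaussianNoise (Fin n) (σ ^ 2).toNNReal)) P := by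
  set q := densityRate d p hdp
  set ν : (Fin n × Fin p) ⊕ (Fin n × Fin p) ⊕ Fin n → Measure ℝ :=
    Sum.elim (fun _ => bernoulliMeasure 1 0 q)
      (Sum.elim (fun _ => gaussianReal 0 1) fun _ => gaussianReal 0 (σ ^ 2).toNNReal)
  have : ∀ i, IsProbabilityMeasure (ν i) := by
    rintro (_ | _ | _) <;> simp only [ν, Sum.elim_inl, Sum.elim_inr] <;> infer_instance
  have hZ : ∀ i, HasLaw (Z i) (gaussianReal 0 (σ ^ 2).toNNReal) P := by
    rw [Real.toNNReal_of_nonneg (sq_nonneg σ)]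
    exact h.law_Z
  have hjoint := iIndepFun.hasLaw_pi (μ := ν) (by
    rintro (_ | _ | _)
    exacts [h.law_B _ _, h.law_N _ _, hZ _]) h.indep
  have hsplit := (measurePreserving_prodAssoc _ _ _).symm.comp <|
    ((MeasurePreserving.id _).prod (measurePreserving_sumPiEquivProdPi fun i => ν (.inr i))).comp
      (measurePreserving_sumPiEquivProdPi ν)
  have hmatrix := (measurePreserving_curry_pi (sparseEntryLaw q)).comp
    (measurePreserving_sparse_mul (Fin n × Fin p) q)
  exact ((hmatrix.prod (MeasurePreserving.id _)).comp hsplit).hasLaw.comp hjoint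

/-- The 0-1 vector supported on `S`. -/
def indicatorVec (S : Finset (Fin p)) : Fin p → ℝ := fun j => if j ∈ S then 1 else 0

theorem supp_indicatorVec (S : Finset (Fin p)) : supp (indicatorVec S) = S := by
  ext j
  simp [supp, indicatorVec]

theorem indicatorVec_mem_signalClass (S : Finset (Fin p)) :
    indicatorVec S ∈ signalClass p S.card := by
  refine ⟨by rw [supp_indicatorVec], fun j hj => ?_⟩
  rw [supp_indicatorVec] at hj
  simp [indicatorVec, hj]

theorem sum_sq_indicatorVec (S : Finset (Fin p)) : ∑ j, indicatorVec S j ^ 2 = S.card := by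
  simp [indicatorVec]

theorem eq_indicatorVec_of_mem {β : Fin p → ℝ} (hβ : β ∈ binarySignals p s) :
    β = indicatorVec (supp β) := by
  ext j
  rcases hβ.1 j with h | h <;> simp [indicatorVec, supp, h]

theorem indicatorVec_sub_mem_signalClass (S T : Finset (Fin p)) :
    indicatorVec S - indicatorVec T ∈ signalClass p (symmDiff S T).card := by
  have habs : ∀ j, |indicatorVec S j - indicatorVec T j| = if j ∈ symmDiff S T then 1 else 0 := by
    intro j
    by_cases hS : j ∈ S <;> by_cases hT : j ∈ T <;>
      simp [indicatorVec, Finset.mem_symmDiff, hS, hT]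
  have hsupp : supp (indicatorVec S - indicatorVec T) = symmDiff S T := by
    ext j
    rw [supp, Finset.mem_filter_univ, Pi.sub_apply, ← abs_ne_zero, habs]
    simp
  refine ⟨by rw [hsupp], fun j hj => ?_⟩
  rw [Pi.sub_apply, habs, if_pos (hsupp ▸ hj)]

theorem IsMLE.sum_sq_le {X : Matrix (Fin n) (Fin p) ℝ} {z : Fin n → ℝ} {β βhat : Fin p → ℝ}
    (hβ : β ∈ binarySignals p s) (h : IsMLE s X (X.mulVec β + z) βhat) :
    ∑ i, (z i + ∑ j, X i j * (β - βhat) j) ^ 2 ≤ ∑ i, z i ^ 2 := by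
  have hmin := h.2 hβ
  simp only [Set.mem_ofPred_eq, EuclideanSpace.norm_sq_eq, Real.norm_eq_abs, sq_abs] at hmin
  have hresidual : ∀ i, (X.mulVec β + z - X.mulVec βhat) i
      = z i + ∑ j, X i j * (β - βhat) j := by
    intro i
    simp only [Pi.sub_apply, Pi.add_apply, Matrix.mulVec, dotProduct, mul_sub,
      Finset.sum_sub_distrib]
    ring
  simpa only [hresidual, add_sub_cancel_left] using hmin

theorem inv_sqrt_add_exp_le {c x y : ℝ} (hc : 0 < c) (hx : 0 < x) (hxy : x ≤ y) :
    (√(1 + y / c))⁻¹ + Real.exp (-(y / 2)) ≤ (√c + 1) / √x := by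
  have := hx.trans_le hxy
  have hsqrt : (√(1 + y / c))⁻¹ ≤ √c / √x := by
    rw [← Real.sqrt_div hc.le, ← Real.sqrt_inv]
    gcongr
    rw [inv_le_comm₀ (by positivity) (by positivity), inv_div]
    calc x / c ≤ y / c := by gcongr
      _ ≤ 1 + y / c := le_add_of_nonneg_left zero_le_one
  have hexp : Real.exp (-(y / 2)) ≤ 1 / √x := by
    rw [Real.exp_neg, ← one_div]
    gcongr
    rw [Real.sqrt_le_iff, ← Real.exp_nat_mul, Nat.cast_ofNat, mul_div_cancel₀ _ two_ne_zero]
    exact ⟨(Real.exp_pos _).le, by linarith [Real.add_one_le_exp y]⟩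
  rw [add_div]
  exact add_le_add hsqrt hexp

theorem IsSparseGaussianModel.measure_residual_le (hσ : 0 < σ)
    (h : IsSparseGaussianModel P d hdp σ B N Z) {m : ℕ} {u : Fin p → ℝ}
    (hu : u ∈ signalClass p m) {x : ℝ} (hx : 0 < x) (hxm : x ≤ m * (d / p)) :
    P {ω | ∑ i, (Z i ω + ∑ j, B i j ω * N i j ω * u j) ^ 2 ≤ ∑ i, Z i ω ^ 2}
      ≤ ENNReal.ofReal ((√(8 * σ ^ 2) + 1) / √x) ^ n := by
  rw [h.hasLaw.measure_eq
    (p := fun t => ∑ i, (t.2 i + ∑ j, t.1 i j * u j) ^ 2 ≤ ∑ i, t.2 i ^ 2)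
    (measurableSet_le (by fun_prop) (by fun_prop))]
  refine (sparseDesignLaw_prod_residual_le _ (Real.toNNReal_pos.mpr (by positivity)).ne'
    hu).trans ?_
  rw [Real.coe_toNNReal _ (sq_nonneg σ)]
  gcongr
  exact inv_sqrt_add_exp_le (by positivity) hx hxm

theorem measure_supportError_le_sum (hs : 0 < s) {β : Fin p → ℝ} (hβ : β ∈ binarySignals p s)
    {βhat : Ω → Fin p → ℝ}
    (hmle : ∀ᵐ ω ∂P, IsMLE s (sparseMatrix B N ω) (observation B N Z β ω) (βhat ω)) (δ : ℝ) :
    P {ω | δ ≤ supportError s (βhat ω) β}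
      ≤ ∑ S ∈ Finset.univ.powersetCard s with 2 * δ * s ≤ (symmDiff (supp β) S).card,
        P {ω | ∑ i, (Z i ω + ∑ j, B i j ω * N i j ω
          * (indicatorVec (supp β) - indicatorVec S) j) ^ 2 ≤ ∑ i, Z i ω ^ 2} := by
  refine (measure_mono_ae ?_).trans (measure_biUnion_finset_le _ _)
  filter_upwards [hmle] with ω hω herror
  replace herror : δ ≤ ((symmDiff (supp (βhat ω)) (supp β)).card : ℝ) / (2 * s) := herror
  rw [le_div_iff₀ (by positivity), symmDiff_comm, ← mul_assoc, mul_comm δ] at herror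
  refine Set.mem_biUnion (x := supp (βhat ω)) (Finset.mem_filter.mpr
    ⟨Finset.mem_powersetCard.mpr ⟨Finset.subset_univ _, hω.1.2⟩, herror⟩) ?_
  rw [← eq_indicatorVec_of_mem hβ, ← eq_indicatorVec_of_mem hω.1]
  exact hω.sum_sq_le hβ

theorem IsSparseGaussianModel.measure_supportError_le (hσ : 0 < σ)
    (h : IsSparseGaussianModel P d hdp σ B N Z) {β : Fin p → ℝ} (hβ : β ∈ binarySignals p s)
    {βhat : Ω → Fin p → ℝ}
    (hmle : ∀ᵐ ω ∂P, IsMLE s (sparseMatrix B N ω) (observation B N Z β ω) (βhat ω))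
    {δ : ℝ} (hδ : 0 < δ) (hsnr : 0 < (d * s / p : ℝ)) :
    P {ω | δ ≤ supportError s (βhat ω) β} ≤ ENNReal.ofReal (Real.exp (Real.log (p.choose s))
      * ((√(8 * σ ^ 2) + 1) / √(2 * δ) / √(d * s / p)) ^ n) := by
  have hs : 0 < s := Nat.pos_of_ne_zero fun hs => by simp [hs] at hsnr
  set 𝒮 := {S ∈ (Finset.univ : Finset (Fin p)).powersetCard s |
    2 * δ * s ≤ (symmDiff (supp β) S).card}
  have hcard : 𝒮.card ≤ p.choose s :=
    (Finset.card_filter_le _ _).trans_eq (by rw [Finset.card_powersetCard, Finset.card_fin])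
  calc P {ω | δ ≤ supportError s (βhat ω) β}
      ≤ ∑ S ∈ 𝒮, P {ω | ∑ i, (Z i ω + ∑ j, B i j ω * N i j ω
          * (indicatorVec (supp β) - indicatorVec S) j) ^ 2 ≤ ∑ i, Z i ω ^ 2} :=
        measure_supportError_le_sum hs hβ hmle δ
    _ ≤ ∑ _S ∈ 𝒮, ENNReal.ofReal ((√(8 * σ ^ 2) + 1) / √(2 * δ * (d * s / p))) ^ n := by
        refine Finset.sum_le_sum fun S hS => h.measure_residual_le hσ
          (indicatorVec_sub_mem_signalClass _ S) (by positivity) ?_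
        calc 2 * δ * (d * s / p) = 2 * δ * s * (d / p) := by ring
          _ ≤ _ := by
            gcongr
            exact (Finset.mem_filter.mp hS).2
    _ ≤ _ := by
        rw [Finset.sum_const, nsmul_eq_mul, div_div, ← Real.sqrt_mul (by positivity),
          ENNReal.ofReal_mul (Real.exp_pos _).le, ENNReal.ofReal_pow (by positivity),
          ← ENNReal.ofReal_natCast]
        gcongr
        exact (Nat.cast_le.mpr hcard).trans (Real.le_exp_log _)

theorem IsSparseGaussianModel.gaussianChannel_error_le
    (h : IsSparseGaussianModel P d hdp σ B N Z) (g : Decoder n p) {S : Finset (Fin p)}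
    (hS : S.card = s) :
    gaussianChannel (sparseDesignLaw n p (densityRate d p hdp)) (σ ^ 2).toNNReal
        (fun X i => ∑ j, X i j * indicatorVec S j) {t | g.toFun t.1 t.2 ≠ S}
      ≤ worstCaseError P s B N Z g := by
  have hg : MeasurableSet {t : (Fin n → Fin p → ℝ) × (Fin n → ℝ) | g.toFun t.1 t.2 ≠ S} :=
    (g.measurable_toFun (measurableSet_singleton S)).compl
  have hchannel : Measurable fun t : (Fin n → Fin p → ℝ) × (Fin n → ℝ) =>
      (t.1, (fun i => ∑ j, t.1 i j * indicatorVec S j) + t.2) := by fun_prop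
  rw [gaussianChannel, Measure.map_apply hchannel hg]
  calc _ = P {ω | g.toFun (sparseMatrix B N ω) (observation B N Z (indicatorVec S) ω)
        ≠ supp (indicatorVec S)} := by
        rw [supp_indicatorVec]
        exact (h.hasLaw.measure_eq (hchannel hg)).symm
    _ ≤ _ := le_iSup₂ (f := fun (β : Fin p → ℝ) (_ : β ∈ signalClass p s) =>
        P {ω | g.toFun (sparseMatrix B N ω) (observation B N Z β ω) ≠ supp β}) _
        (hS ▸ indicatorVec_mem_signalClass S)

theorem IsSparseGaussianModel.choose_le (hσ : 0 < σ)
    (h : IsSparseGaussianModel P d hdp σ B N Z) (g : Decoder n p) :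
    (p.choose s : ℝ≥0∞) ≤ p.choose s * (worstCaseError P s B N Z g + 2⁻¹)
      + ENNReal.ofReal ((Real.exp 1 * √(1 + d * s / p / σ ^ 2)) ^ n) := by
  set 𝒮 := (Finset.univ : Finset (Fin p)).powersetCard s
  have hcard : 𝒮.card = p.choose s := by rw [Finset.card_powersetCard, Finset.card_fin]
  have hpower : ∀ S ∈ 𝒮, ∫⁻ X, ENNReal.ofReal (∑ i, (∑ j, X i j * indicatorVec S j) ^ 2)
      ∂sparseDesignLaw n p (densityRate d p hdp)
      ≤ Fintype.card (Fin n) * (Real.toNNReal (d * s / p) : ℝ≥0∞) := by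
    intro S hS
    rw [lintegral_sum_sq_sparseDesignLaw, sum_sq_indicatorVec, (Finset.mem_powersetCard.mp hS).2,
      Fintype.card_fin]
    refine le_of_eq ?_
    congr 2
    exact div_mul_eq_mul_div _ _ _
  have hcode := card_le_sum_gaussianChannel_error_add
    (sparseDesignLaw n p (densityRate d p hdp)) (v := (σ ^ 2).toNNReal)
    (Real.toNNReal_pos.mpr (by positivity)).ne' (f := fun S X i => ∑ j, X i j * indicatorVec S j)
    (fun S => by fun_prop) 𝒮 hpower g.measurable_toFun
  rw [hcard, Fintype.card_fin, Real.coe_toNNReal _ (sq_nonneg σ),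
    Real.coe_toNNReal _ (by positivity)] at hcode
  refine hcode.trans ?_
  gcongr
  refine (Finset.sum_le_sum fun S hS => add_le_add_left
    (h.gaussianChannel_error_le g (Finset.mem_powersetCard.mp hS).2) _).trans_eq ?_
  rw [Finset.sum_const, hcard, nsmul_eq_mul]

theorem IsSparseGaussianModel.one_le_worstCaseError_add (hσ : 0 < σ)
    (h : IsSparseGaussianModel P d hdp σ B N Z) (g : Decoder n p) (hsp : s ≤ p) :
    1 ≤ worstCaseError P s B N Z g + 2⁻¹ + ENNReal.ofReal (Real.exp (-Real.log (p.choose s))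
      * (Real.exp 1 * √(1 + d * s / p / σ ^ 2)) ^ n) := by
  have hpos : 0 < p.choose s := Nat.choose_pos hsp
  have hpos' : (0 : ℝ) < p.choose s := by exact_mod_cast hpos
  have hne : (p.choose s : ℝ≥0∞) ≠ 0 := by exact_mod_cast hpos.ne'
  rw [← ENNReal.mul_le_mul_iff_right hne (ENNReal.natCast_ne_top _), mul_one, mul_add _ (_ + _),
    ENNReal.ofReal_mul (Real.exp_pos _).le, Real.exp_neg, Real.exp_log hpos',
    ENNReal.ofReal_inv_of_pos hpos', ENNReal.ofReal_natCast, ← mul_assoc,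
    ENNReal.mul_inv_cancel hne (ENNReal.natCast_ne_top _), one_mul]
  exact h.choose_le hσ g

end Model

section ExponentialLimits

variable {κ : Type*} {l : Filter κ} {n : κ → ℕ} {L x : κ → ℝ} {η : ℝ}

theorem eventually_const_le_mul_log {c : ℝ} (hc : 0 < c) (hx : Tendsto x l atTop) (b : ℝ) :
    ∀ᶠ k in l, b ≤ c * Real.log (x k) :=
  ((Real.tendsto_log_atTop.comp hx).const_mul_atTop hc).eventually_ge_atTop b

theorem tendsto_exp_mul_div_sqrt_pow {C : ℝ} (hC : 0 < C) (hη : 0 < η)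
    (hx : Tendsto x l atTop) (hL : Tendsto L l atTop)
    (hn : ∀ᶠ k in l, L k ≤ (1 - η) * (n k / 2 * Real.log (x k))) :
    Tendsto (fun k => Real.exp (L k) * (C / √(x k)) ^ n k) l (𝓝 0) := by
  have hlim : Tendsto (fun k => Real.exp (-(η / 2 * L k))) l (𝓝 0) :=
    Real.tendsto_exp_neg_atTop_nhds_zero.comp (hL.const_mul_atTop (half_pos hη))
  refine squeeze_zero' (Eventually.of_forall fun k => by positivity) ?_ hlim
  filter_upwards [hn, hx.eventually_gt_atTop 1,
    eventually_const_le_mul_log (by positivity : 0 < η / 4) hx (Real.log C)] with k hnk hxk hCk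
  have hx0 : 0 < x k := one_pos.trans hxk
  have hlog : 0 ≤ Real.log (x k) := Real.log_nonneg hxk.le
  have hgain : 0 ≤ η * (n k / 2 * Real.log (x k)) := by positivity
  have hbase : C / √(x k) ≤ Real.exp (-((1 - η / 2) * (Real.log (x k) / 2))) := by
    rw [← Real.log_le_iff_le_exp (by positivity), Real.log_div hC.ne' (by positivity),
      Real.log_sqrt hx0.le]
    linarith
  calc Real.exp (L k) * (C / √(x k)) ^ n k
      ≤ Real.exp (L k) * Real.exp (-((1 - η / 2) * (Real.log (x k) / 2))) ^ n k := by gcongr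
    _ = Real.exp (L k - (1 - η / 2) * (n k / 2 * Real.log (x k))) := by
        rw [← Real.exp_nat_mul, ← Real.exp_add]
        ring_nf
    _ ≤ Real.exp (-(η / 2 * L k)) := by
        gcongr
        nlinarith

theorem tendsto_exp_neg_mul_sqrt_pow {C : ℝ} (hC : 0 < C) (hη : 0 < η)
    (hx : Tendsto x l atTop) (hL : Tendsto L l atTop)
    (hn : ∀ᶠ k in l, n k / 2 * Real.log (x k) ≤ (1 - η) * L k) :
    Tendsto (fun k => Real.exp (-L k) * √(C * x k) ^ n k) l (𝓝 0) := by
  have hlim : Tendsto (fun k => Real.exp (-(η ^ 2 * L k))) l (𝓝 0) :=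
    Real.tendsto_exp_neg_atTop_nhds_zero.comp (hL.const_mul_atTop (by positivity))
  refine squeeze_zero' (Eventually.of_forall fun k => by positivity) ?_ hlim
  filter_upwards [hn, hx.eventually_gt_atTop 0,
    eventually_const_le_mul_log hη hx (Real.log C)] with k hnk hx0 hCk
  have hbase : √(C * x k) ≤ Real.exp ((1 + η) * (Real.log (x k) / 2)) := by
    rw [← Real.log_le_iff_le_exp (by positivity), Real.log_sqrt (by positivity),
      Real.log_mul hC.ne' hx0.ne']
    linarith
  calc Real.exp (-L k) * √(C * x k) ^ n k
      ≤ Real.exp (-L k) * Real.exp ((1 + η) * (Real.log (x k) / 2)) ^ n k := by gcongr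
    _ = Real.exp (-L k + (1 + η) * (n k / 2 * Real.log (x k))) := by
        rw [← Real.exp_nat_mul, ← Real.exp_add]
        ring_nf
    _ ≤ Real.exp (-L k + (1 + η) * ((1 - η) * L k)) := by gcongr
    _ = Real.exp (-(η ^ 2 * L k)) := by ring_nf

theorem tendsto_exp_neg_mul_sqrt_one_add_pow {v : ℝ} (hv : 0 < v) (hη : 0 < η)
    (hx : Tendsto x l atTop) (hL : Tendsto L l atTop)
    (hn : ∀ᶠ k in l, n k / 2 * Real.log (x k) ≤ (1 - η) * L k) :
    Tendsto (fun k => Real.exp (-L k) * (Real.exp 1 * √(1 + x k / v)) ^ n k) l (𝓝 0) := by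
  refine squeeze_zero' (Eventually.of_forall fun k => by positivity) ?_
    (tendsto_exp_neg_mul_sqrt_pow (C := Real.exp 1 ^ 2 * (1 + 1 / v)) (by positivity) hη hx hL hn)
  filter_upwards [hx.eventually_ge_atTop 1] with k hxk
  rw [mul_assoc (_ ^ 2), Real.sqrt_mul (by positivity), Real.sqrt_sq (Real.exp_pos _).le]
  gcongr
  calc 1 + x k / v ≤ x k + x k / v := by gcongr
    _ = (1 + 1 / v) * x k := by ring

end ExponentialLimits

section Transition

variable {κ : Type*} {l : Filter κ} {n p s d : κ → ℕ} {hdp : ∀ k, d k ≤ p k} {σ η : ℝ}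
  {Ω : κ → Type*} [∀ k, MeasurableSpace (Ω k)] {P : ∀ k, Measure (Ω k)}
  {B N : ∀ k, Fin (n k) → Fin (p k) → Ω k → ℝ} {Z : ∀ k, Fin (n k) → Ω k → ℝ}

theorem not_tendsto_worstCaseError [l.NeBot] (hσ : 0 < σ)
    (hmodel : ∀ k, IsSparseGaussianModel (P k) (d k) (hdp k) σ (B k) (N k) (Z k))
    (hds : Tendsto (fun k => (d k : ℝ) * s k / p k) l atTop)
    (hchoose : Tendsto (fun k => Real.log ((p k).choose (s k))) l atTop) (hη : 0 < η)
    (hn : ∀ᶠ k in l, n k / 2 * Real.log ((d k : ℝ) * s k / p k)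
      ≤ (1 - η) * Real.log ((p k).choose (s k)))
    (g : ∀ k, Decoder (n k) (p k)) :
    ¬ Tendsto (fun k => worstCaseError (P k) (s k) (B k) (N k) (Z k) (g k)) l (𝓝 0) := by
  intro herror
  have hlim := (herror.add_const 2⁻¹).add (ENNReal.tendsto_ofReal
    (tendsto_exp_neg_mul_sqrt_one_add_pow (pow_pos hσ 2) hη hds hchoose hn))
  rw [zero_add, ENNReal.ofReal_zero, add_zero] at hlim
  refine (ENNReal.inv_lt_one.mpr ENNReal.one_lt_two).not_ge (ge_of_tendsto hlim ?_)
  filter_upwards [hchoose.eventually_gt_atTop 0] with k hk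
  refine (hmodel k).one_le_worstCaseError_add hσ (g k) (le_of_not_gt fun hlt => ?_)
  simp [Nat.choose_eq_zero_of_lt hlt] at hk

theorem tendsto_measure_supportError (hσ : 0 < σ)
    (hmodel : ∀ k, IsSparseGaussianModel (P k) (d k) (hdp k) σ (B k) (N k) (Z k))
    (hds : Tendsto (fun k => (d k : ℝ) * s k / p k) l atTop)
    (hchoose : Tendsto (fun k => Real.log ((p k).choose (s k))) l atTop) (hη : 0 < η)
    (hn : ∀ᶠ k in l, Real.log ((p k).choose (s k))
      ≤ (1 - η) * (n k / 2 * Real.log ((d k : ℝ) * s k / p k)))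
    {β : ∀ k, Fin (p k) → ℝ} (hβ : ∀ k, β k ∈ binarySignals (p k) (s k))
    {βhat : ∀ k, Ω k → Fin (p k) → ℝ}
    (hmle : ∀ k, ∀ᵐ ω ∂P k, IsMLE (s k) (sparseMatrix (B k) (N k) ω)
      (observation (B k) (N k) (Z k) (β k) ω) (βhat k ω)) {δ : ℝ} (hδ : 0 < δ) :
    Tendsto (fun k => P k {ω | δ ≤ supportError (s k) (βhat k ω) (β k)}) l (𝓝 0) := by
  have hlim := ENNReal.tendsto_ofReal (tendsto_exp_mul_div_sqrt_pow
    (C := (√(8 * σ ^ 2) + 1) / √(2 * δ)) (by positivity) hη hds hchoose hn)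
  rw [ENNReal.ofReal_zero] at hlim
  refine tendsto_of_tendsto_of_tendsto_of_le_of_le' tendsto_const_nhds hlim
    (Eventually.of_forall fun _ => zero_le) ?_
  filter_upwards [hds.eventually_gt_atTop 0] with k hk
  exact (hmodel k).measure_supportError_le hσ (hβ k) (hmle k) hδ hk

end Transition

theorem phaseTransitionAt_of_isEquivalent {σ : ℝ} (hσ : 0 < σ) {n p s d : ℕ → ℕ}
    {hdp : ∀ k, d k ≤ p k} {Ω : ℕ → Type*} [∀ k, MeasurableSpace (Ω k)]
    {P : ∀ k, Measure (Ω k)} {B N : ∀ k, Fin (n k) → Fin (p k) → Ω k → ℝ}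
    {Z : ∀ k, Fin (n k) → Ω k → ℝ}
    (hmodel : ∀ k, IsSparseGaussianModel (P k) (d k) (hdp k) σ (B k) (N k) (Z k))
    (hds : Tendsto (fun k => (d k : ℝ) * s k / p k) atTop atTop)
    (hchoose : Tendsto (fun k => Real.log ((p k).choose (s k))) atTop atTop) {τ : ℕ → ℝ}
    (hτ : τ ~[atTop] fun k => 2 * Real.log ((p k).choose (s k))
      / Real.log ((d k : ℝ) * s k / p k)) :
    PhaseTransitionAt P n p s B N Z τ := by
  obtain ⟨φ, hφ, hτφ⟩ := hτ.exists_eq_mul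
  have hscale : ∀ᶠ k in atTop, 0 < Real.log ((d k : ℝ) * s k / p k)
      ∧ 0 < Real.log ((p k).choose (s k))
      ∧ τ k / 2 * Real.log ((d k : ℝ) * s k / p k) = φ k * Real.log ((p k).choose (s k)) := by
    filter_upwards [hτφ, (Real.tendsto_log_atTop.comp hds).eventually_gt_atTop 0,
      hchoose.eventually_gt_atTop 0] with k hk hlog hL
    refine ⟨hlog, hL, ?_⟩
    have : Real.log ((d k : ℝ) * s k / p k) ≠ 0 := hlog.ne'
    rw [hk, Pi.mul_apply]
    field_simp
  refine ⟨fun ε hε hn => ?_, fun ε hε hn β hβ βhat hmle δ hδ => ?_⟩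
  · rintro ⟨g, hg⟩
    refine not_tendsto_worstCaseError hσ hmodel hds hchoose (half_pos hε) ?_ g hg
    filter_upwards [hn, hscale, (hφ.const_mul (1 - ε)).eventually_le_const
      (u := 1 - ε / 2) (by linarith)] with k hnk ⟨hlog, hL, hτk⟩ hφk
    calc n k / 2 * Real.log ((d k : ℝ) * s k / p k)
        ≤ (1 - ε) * τ k / 2 * Real.log ((d k : ℝ) * s k / p k) := by gcongr
      _ = (1 - ε) * φ k * Real.log ((p k).choose (s k)) := by
        rw [mul_div_assoc, mul_assoc, hτk, mul_assoc]
      _ ≤ _ := by gcongr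
  · obtain ⟨η, hη, hηε⟩ : ∃ η : ℝ, 0 < η ∧ η < 1 ∧ 1 < (1 - η) * (1 + ε) := by
      refine ⟨ε / (2 * (1 + ε)), by positivity, ?_, ?_⟩ <;> field_simp <;> linarith
    refine tendsto_measure_supportError hσ hmodel hds hchoose hη ?_ hβ hmle hδ
    filter_upwards [hn, hscale, (hφ.const_mul ((1 - η) * (1 + ε))).eventually_const_le
      (u := 1) (by linarith)] with k hnk ⟨hlog, hL, hτk⟩ hφk
    have := sub_pos.mpr hηε.1
    calc Real.log ((p k).choose (s k))
        ≤ (1 - η) * (1 + ε) * φ k * Real.log ((p k).choose (s k)) := le_mul_of_one_le_left hL.le hφk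
      _ = (1 - η) * ((1 + ε) * τ k / 2 * Real.log ((d k : ℝ) * s k / p k)) := by
        rw [mul_div_assoc, mul_assoc (1 + ε), hτk]
        ring
      _ ≤ _ := by gcongr

section Binomial

theorem div_pow_le_choose {p s : ℕ} (hsp : s ≤ p) : ((p : ℝ) / s) ^ s ≤ p.choose s := by
  have hmul : p ^ s * s.descFactorial s ≤ s ^ s * p.descFactorial s := by
    have hpow (a : ℕ) : a ^ s = ∏ _i ∈ Finset.range s, a := by simp
    rw [hpow p, hpow s, Nat.descFactorial_eq_prod_range, Nat.descFactorial_eq_prod_range,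
      ← Finset.prod_mul_distrib, ← Finset.prod_mul_distrib]
    refine Finset.prod_le_prod' fun i _ => ?_
    rw [Nat.mul_sub, Nat.mul_sub, mul_comm s p]
    gcongr
  have hself : (0 : ℝ) < (s : ℝ) ^ s := by exact_mod_cast Nat.pow_self_pos
  rw [Nat.descFactorial_self, Nat.descFactorial_eq_factorial_mul_choose, mul_left_comm,
    mul_comm (p ^ s)] at hmul
  rw [div_pow, div_le_iff₀' hself]
  exact_mod_cast Nat.le_of_mul_le_mul_left hmul s.factorial_pos

theorem mul_log_div_le_log_choose {p s : ℕ} (hs : 0 < s) (hsp : s ≤ p) :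
    s * Real.log (p / s) ≤ Real.log (p.choose s) := by
  have : 0 < p := hs.trans_le hsp
  rw [← Real.log_pow]
  exact Real.log_le_log (by positivity) (div_pow_le_choose hsp)

theorem choose_le_div_pow_mul_exp (p s : ℕ) :
    (p.choose s : ℝ) ≤ (p / s) ^ s * Real.exp s := by
  have hself : (s : ℝ) ^ s ≠ 0 := by exact_mod_cast Nat.pow_self_pos.ne'
  calc (p.choose s : ℝ) ≤ p ^ s / s.factorial := Nat.choose_le_pow_div s p
    _ = (p / s) ^ s * (s ^ s / s.factorial) := by rw [div_pow, div_mul_div_cancel₀ hself]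
    _ ≤ (p / s) ^ s * Real.exp s := by
        gcongr
        exact Real.pow_div_factorial_le_exp _ (Nat.cast_nonneg s) _

theorem log_choose_le_mul_log_div_add {p s : ℕ} (hs : 0 < s) (hsp : s ≤ p) :
    Real.log (p.choose s) ≤ s * Real.log (p / s) + s := by
  have : 0 < p := hs.trans_le hsp
  have : 0 < p.choose s := Nat.choose_pos hsp
  calc Real.log (p.choose s) ≤ Real.log ((p / s) ^ s * Real.exp s) :=
        Real.log_le_log (by positivity) (choose_le_div_pow_mul_exp p s)
    _ = s * Real.log (p / s) + s := by
        rw [Real.log_mul (by positivity) (by positivity), Real.log_pow, Real.log_exp]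

/-- The error term in Stirling's formula `log n! ≈ n log n - n`. -/
def stirlingError (n : ℕ) : ℝ := Real.log n.factorial - (n * Real.log n - n)

theorem stirlingError_isLittleO : stirlingError =o[atTop] fun n : ℕ => (n : ℝ) := by
  have hcast : Tendsto (fun n : ℕ => (n : ℝ)) atTop atTop := tendsto_natCast_atTop_atTop
  have hconst (c : ℝ) : (fun _ : ℕ => c) =o[atTop] fun n : ℕ => (n : ℝ) :=
    isLittleO_const_left.mpr (Or.inr (tendsto_norm_atTop_atTop.comp hcast))
  have hseq : (fun n => Real.log (Stirling.stirlingSeq n)) =o[atTop] fun n : ℕ => (n : ℝ) :=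
    ((Stirling.tendsto_stirlingSeq_sqrt_pi.log (by positivity)).isBigO_one ℝ).trans_isLittleO
      (hconst 1)
  have hlog : (fun n : ℕ => Real.log n) =o[atTop] fun n : ℕ => (n : ℝ) :=
    Real.isLittleO_log_id_atTop.comp_tendsto hcast
  refine (hseq.add (((hconst (Real.log 2)).add hlog).const_mul_left (1 / 2))).congr' ?_ .rfl
  filter_upwards [eventually_gt_atTop 0] with n hn
  have : (0 : ℝ) < n := by exact_mod_cast hn
  rw [Stirling.log_stirlingSeq_formula, stirlingError, Real.log_mul (by positivity) (by positivity),
    Real.log_div (by positivity) (by positivity), Real.log_exp]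
  ring

theorem log_choose_eq_binEntropy_mul_add {p s : ℕ} (hs : 0 < s) (hsp : s < p) :
    Real.log (p.choose s) = Real.binEntropy (s / p) * p
      + (stirlingError p - stirlingError s - stirlingError (p - s)) := by
  have hs' : (0 : ℝ) < s := by exact_mod_cast hs
  have hp' : (0 : ℝ) < p := by exact_mod_cast hs.trans hsp
  have hps : (0 : ℝ) < p - s := by rw [sub_pos]; exact_mod_cast hsp
  have hfactorial (m : ℕ) : (m.factorial : ℝ) ≠ 0 := by exact_mod_cast m.factorial_ne_zero
  have hcompl : (1 : ℝ) - s / p = (p - s) / p := by field_simp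
  rw [Nat.cast_choose ℝ hsp.le,
    Real.log_div (hfactorial _) (mul_ne_zero (hfactorial _) (hfactorial _)),
    Real.log_mul (hfactorial _) (hfactorial _)]
  simp only [stirlingError, Real.binEntropy, Real.log_inv]
  rw [hcompl, Nat.cast_sub hsp.le, Real.log_div hs'.ne' hp'.ne', Real.log_div hps.ne' hp'.ne']
  field_simp
  ring

variable {κ : Type*} {l : Filter κ} {p s d : κ → ℕ} {α : ℝ}

theorem eventually_le_of_isLittleO (hsmall : (fun k => (s k : ℝ)) =o[l] fun k => (p k : ℝ)) :
    ∀ᶠ k in l, s k ≤ p k := by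
  filter_upwards [hsmall.bound one_pos] with k hk
  simpa using hk

theorem tendsto_log_div_atTop (hs : Tendsto s l atTop)
    (hsmall : (fun k => (s k : ℝ)) =o[l] fun k => (p k : ℝ)) :
    Tendsto (fun k => Real.log ((p k : ℝ) / s k)) l atTop := by
  have hpos : ∀ᶠ k in l, (0 : ℝ) < s k / p k := by
    filter_upwards [hs.eventually_gt_atTop 0, eventually_le_of_isLittleO hsmall] with k hk hsp
    have := hk.trans_le hsp
    positivity
  refine Real.tendsto_log_atTop.comp (Tendsto.congr (fun k => inv_div _ _) ?_)
  exact (tendsto_nhdsWithin_iff.mpr ⟨hsmall.tendsto_div_nhds_zero, hpos⟩).inv_tendsto_nhdsGT_zero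

theorem log_choose_isEquivalent_of_isLittleO (hs : Tendsto s l atTop)
    (hsmall : (fun k => (s k : ℝ)) =o[l] fun k => (p k : ℝ)) :
    (fun k => Real.log ((p k).choose (s k))) ~[l] fun k => s k * Real.log (p k / s k) := by
  have hbound : (fun k => Real.log ((p k).choose (s k)) - s k * Real.log (p k / s k)) =O[l]
      fun k => (s k : ℝ) * 1 := by
    refine .of_bound 1 ?_
    filter_upwards [hs.eventually_gt_atTop 0, eventually_le_of_isLittleO hsmall] with k hk hsp
    rw [Real.norm_of_nonneg (sub_nonneg.mpr (mul_log_div_le_log_choose hk hsp)), mul_one, one_mul,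
      Real.norm_natCast, sub_le_iff_le_add']
    exact log_choose_le_mul_log_div_add hk hsp
  refine hbound.trans_isLittleO ((isBigO_refl _ l).mul_isLittleO ?_)
  exact isLittleO_const_left.mpr
    (Or.inr (tendsto_norm_atTop_atTop.comp (tendsto_log_div_atTop hs hsmall)))

theorem eventually_lt_of_tendsto_div (hα0 : α ≠ 0) (hα1 : α < 1)
    (hsp : Tendsto (fun k => (s k : ℝ) / p k) l (𝓝 α)) : ∀ᶠ k in l, s k < p k := by
  filter_upwards [hsp.eventually_ne hα0, hsp.eventually_lt_const hα1] with k hk hlt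
  have hp : p k ≠ 0 := fun hp => hk (by simp [hp])
  rw [div_lt_one (by positivity)] at hlt
  exact_mod_cast hlt

theorem tendsto_atTop_of_tendsto_div (hα0 : α ≠ 0) (hα1 : α < 1) (hs : Tendsto s l atTop)
    (hsp : Tendsto (fun k => (s k : ℝ) / p k) l (𝓝 α)) : Tendsto p l atTop :=
  tendsto_atTop_mono' l ((eventually_lt_of_tendsto_div hα0 hα1 hsp).mono fun _ => le_of_lt) hs

theorem tendsto_sub_atTop_of_tendsto_div (hα0 : α ≠ 0) (hα1 : α < 1) (hs : Tendsto s l atTop)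
    (hsp : Tendsto (fun k => (s k : ℝ) / p k) l (𝓝 α)) :
    Tendsto (fun k => p k - s k) l atTop := by
  rw [← tendsto_natCast_atTop_iff (R := ℝ)]
  refine ((hsp.const_sub 1).pos_mul_atTop (sub_pos.mpr hα1) (tendsto_natCast_atTop_iff.mpr
    (tendsto_atTop_of_tendsto_div hα0 hα1 hs hsp))).congr' ?_
  filter_upwards [eventually_lt_of_tendsto_div hα0 hα1 hsp] with k hk
  have : p k ≠ 0 := hk.ne_bot
  rw [Nat.cast_sub hk.le]
  field_simp

theorem log_choose_isEquivalent_of_tendsto_div (hα0 : 0 < α) (hα1 : α < 1)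
    (hs : Tendsto s l atTop) (hsp : Tendsto (fun k => (s k : ℝ) / p k) l (𝓝 α)) :
    (fun k => Real.log ((p k).choose (s k))) ~[l] fun k => Real.binEntropy α * p k := by
  have hH : Real.binEntropy α ≠ 0 := (Real.binEntropy_pos hα0 hα1).ne'
  have hlt := eventually_lt_of_tendsto_div hα0.ne' hα1 hsp
  have hp := tendsto_atTop_of_tendsto_div hα0.ne' hα1 hs hsp
  have hentropy : (fun k => Real.binEntropy (s k / p k) * p k) ~[l]
      fun k => Real.binEntropy α * p k :=
    ((isEquivalent_const_iff_tendsto hH).mpr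
      ((Real.binEntropy_continuous.tendsto α).comp hsp)).mul .refl
  have herror {m : κ → ℕ} (hm : Tendsto m l atTop) (hmp : ∀ᶠ k in l, m k ≤ p k) :
      (fun k => stirlingError (m k)) =o[l] fun k => Real.binEntropy α * p k := by
    refine (stirlingError_isLittleO.comp_tendsto hm).trans_isBigO
      ((IsBigO.of_bound 1 ?_).const_mul_right hH)
    filter_upwards [hmp] with k hk
    simpa using hk
  refine (hentropy.add_isLittleO (((herror hp (.of_forall fun _ => le_rfl)).sub
    (herror hs (hlt.mono fun _ => le_of_lt))).sub
    (herror (tendsto_sub_atTop_of_tendsto_div hα0.ne' hα1 hs hsp)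
      (.of_forall fun _ => Nat.sub_le _ _)))).congr_left ?_
  filter_upwards [hlt, hs.eventually_gt_atTop 0] with k hk hsk
  exact (log_choose_eq_binEntropy_mul_add hsk hk).symm

theorem log_mul_div_isEquivalent_log (hα : α ≠ 0) (hd : Tendsto d l atTop)
    (hsp : Tendsto (fun k => (s k : ℝ) / p k) l (𝓝 α)) :
    (fun k => Real.log ((d k : ℝ) * s k / p k)) ~[l] fun k => Real.log (d k) := by
  have hlog : Tendsto (fun k => Real.log (d k)) l atTop :=
    Real.tendsto_log_atTop.comp (tendsto_natCast_atTop_iff.mpr hd)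
  have hratio : (fun k => Real.log ((s k : ℝ) / p k)) =o[l] fun k => Real.log (d k) :=
    ((hsp.log hα).isBigO_one ℝ).trans_isLittleO
      (isLittleO_const_left.mpr (Or.inr (tendsto_norm_atTop_atTop.comp hlog)))
  refine (IsEquivalent.refl.add_isLittleO hratio).congr_left ?_
  filter_upwards [hd.eventually_gt_atTop 0, hsp.eventually_ne hα] with k hdk hspk
  rw [Pi.add_apply, mul_div_assoc, Real.log_mul (by positivity) hspk]

end Binomial

section Threshold

variable {κ : Type*} {l : Filter κ} {p s d : κ → ℕ} {α : ℝ}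

theorem thresholdSublinear_isEquivalent (hs : Tendsto s l atTop)
    (hsmall : (fun k => (s k : ℝ)) =o[l] fun k => (p k : ℝ)) :
    (fun k => thresholdSublinear (p k) (s k) (d k)) ~[l] fun k =>
      2 * Real.log ((p k).choose (s k)) / Real.log ((d k : ℝ) * s k / p k) := by
  simp only [thresholdSublinear, mul_assoc]
  exact (IsEquivalent.refl.mul (log_choose_isEquivalent_of_isLittleO hs hsmall).symm).div .refl

theorem thresholdLinear_isEquivalent (hα0 : 0 < α) (hα1 : α < 1) (hs : Tendsto s l atTop)
    (hd : Tendsto d l atTop)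
    (hsp : Tendsto (fun k => (s k : ℝ) / p k) l (𝓝 α)) :
    (fun k => thresholdLinear α (p k) (d k)) ~[l] fun k =>
      2 * Real.log ((p k).choose (s k)) / Real.log ((d k : ℝ) * s k / p k) := by
  simp only [thresholdLinear, mul_assoc]
  exact (IsEquivalent.refl.mul
    (log_choose_isEquivalent_of_tendsto_div hα0 hα1 hs hsp).symm).div
    (log_mul_div_isEquivalent_log hα0.ne' hd hsp).symm

theorem tendsto_log_choose_of_isLittleO (hs : Tendsto s l atTop)
    (hsmall : (fun k => (s k : ℝ)) =o[l] fun k => (p k : ℝ)) :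
    Tendsto (fun k => Real.log ((p k).choose (s k))) l atTop :=
  (log_choose_isEquivalent_of_isLittleO hs hsmall).symm.tendsto_atTop
    ((tendsto_natCast_atTop_iff.mpr hs).atTop_mul_atTop₀ (tendsto_log_div_atTop hs hsmall))

theorem tendsto_log_choose_of_tendsto_div (hα0 : 0 < α) (hα1 : α < 1) (hs : Tendsto s l atTop)
    (hsp : Tendsto (fun k => (s k : ℝ) / p k) l (𝓝 α)) :
    Tendsto (fun k => Real.log ((p k).choose (s k))) l atTop :=
  (log_choose_isEquivalent_of_tendsto_div hα0 hα1 hs hsp).symm.tendsto_atTop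
    ((tendsto_natCast_atTop_iff.mpr
      (tendsto_atTop_of_tendsto_div hα0.ne' hα1 hs hsp)).const_mul_atTop
        (Real.binEntropy_pos hα0 hα1))

theorem tendsto_atTop_of_mul_div_natCast {a b c : κ → ℕ} (hac : ∀ᶠ k in l, a k ≤ c k)
    (h : Tendsto (fun k => (a k : ℝ) * b k / c k) l atTop) : Tendsto b l atTop := by
  rw [← tendsto_natCast_atTop_iff (R := ℝ)]
  refine tendsto_atTop_mono' l ?_ h
  filter_upwards [hac] with k hk
  rw [mul_div_right_comm]
  exact mul_le_of_le_one_left (by positivity)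
    (div_le_one_of_le₀ (by exact_mod_cast hk) (by positivity))

end Threshold

end SparseRecovery

end

theorem corollary1_general
    {σ : ℝ} (hσ : 0 < σ) {n p s d : ℕ → ℕ} (hdp : ∀ k, d k ≤ p k)
    (hds : Tendsto (fun k => (d k : ℝ) * s k / p k) atTop atTop)
    {Ω : ℕ → Type*} [∀ k, MeasurableSpace (Ω k)] {P : ∀ k, Measure (Ω k)}
    {B N : ∀ k, Fin (n k) → Fin (p k) → Ω k → ℝ} {Z : ∀ k, Fin (n k) → Ω k → ℝ}
    (hmodel : ∀ k,
      SparseRecovery.IsSparseGaussianModel (P k) (d k) (hdp k) σ (B k) (N k) (Z k)) :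
    (((fun k => (s k : ℝ)) =o[atTop] fun k => (p k : ℝ)) →
      SparseRecovery.PhaseTransitionAt P n p s B N Z
        (fun k => SparseRecovery.thresholdSublinear (p k) (s k) (d k))) ∧
    (∀ α : ℝ, 0 < α → α < 1 →
      Tendsto (fun k => (s k : ℝ) / p k) atTop (𝓝 α) →
      SparseRecovery.PhaseTransitionAt P n p s B N Z
        (fun k => SparseRecovery.thresholdLinear α (p k) (d k))) := by
  have hs : Tendsto s atTop atTop :=
    SparseRecovery.tendsto_atTop_of_mul_div_natCast (.of_forall hdp) hds
  refine ⟨fun hsmall => ?_, fun α hα0 hα1 hsp => ?_⟩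
  · exact SparseRecovery.phaseTransitionAt_of_isEquivalent hσ hmodel hds
      (SparseRecovery.tendsto_log_choose_of_isLittleO hs hsmall)
      (SparseRecovery.thresholdSublinear_isEquivalent hs hsmall)
  · have hlt := SparseRecovery.eventually_lt_of_tendsto_div hα0.ne' hα1 hsp
    have hd : Tendsto d atTop atTop :=
      SparseRecovery.tendsto_atTop_of_mul_div_natCast (hlt.mono fun _ => le_of_lt)
        (hds.congr fun k => by rw [mul_comm (d k : ℝ)])
    exact SparseRecovery.phaseTransitionAt_of_isEquivalent hσ hmodel hds
      (SparseRecovery.tendsto_log_choose_of_tendsto_div hα0 hα1 hs hsp)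
      (SparseRecovery.thresholdLinear_isEquivalent hα0 hα1 hs hd hsp)

theorem corollary1
    (σ : ℝ) (hσ : 0 < σ)
    (n p s d : ℕ → ℕ)
    (hsp : ∀ k, s k ≤ p k) (hdp : ∀ k, d k ≤ p k)
    (hp_top : Tendsto p atTop atTop) (hs_top : Tendsto s atTop atTop)
    (hd_top : Tendsto d atTop atTop)
    (hd_small : (fun k => (d k : ℝ)) =o[atTop] fun k => (p k : ℝ))
    (hds : Tendsto (fun k => (d k : ℝ) * s k / p k) atTop atTop)
    {Ω : ℕ → Type*} [∀ k, MeasurableSpace (Ω k)]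
    (P : ∀ k, Measure (Ω k)) [∀ k, IsProbabilityMeasure (P k)]
    (B N : ∀ k, Fin (n k) → Fin (p k) → Ω k → ℝ) (Z : ∀ k, Fin (n k) → Ω k → ℝ)
    (hmodel : ∀ k,
      SparseRecovery.IsSparseGaussianModel (P k) (d k) (hdp k) σ (B k) (N k) (Z k)) :
    -- sublinear sparsity
    (((fun k => (s k : ℝ)) =o[atTop] fun k => (p k : ℝ)) →
      SparseRecovery.PhaseTransitionAt P n p s B N Z
        (fun k => SparseRecovery.thresholdSublinear (p k) (s k) (d k))) ∧
    -- linear sparsity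
    (∀ α : ℝ, 0 < α → α < 1 →
      Tendsto (fun k => (s k : ℝ) / p k) atTop (𝓝 α) →
      SparseRecovery.PhaseTransitionAt P n p s B N Z
        (fun k => SparseRecovery.thresholdLinear α (p k) (d k))) := by
  exact corollary1_general hσ hdp hds hmodel
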